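/- Let $\gamma\in(0,1)$, let $N=\lfloor 1/\gamma\rfloor$, let $T\ge 0$ and let $d$ be a natural number. Let $\mathcal W$ be the set of words over $\{1,\dots,d\}$, with empty word $\mathbf 1$ and length $|w|$, and let $\mathcal W^n$ be the set of words of length at most $n$. Write $\langle\mathcal W\rangle$ and $\langle\mathcal W^n\rangle$ for the free real vector spaces on these sets and $V^*$ for the algebraic dual of $V$. Let $T((\mathbb R^d))=\prod_{n\ge 0}(\mathbb R^d)^{\otimes n}$ be the space of tensor series $g=\sum_{w}\langle w,g\rangle\,w$, where the word $i_1\cdots i_n$ stands for $e_{i_1}\otimes\cdots\otimes e_{i_n}$, with the concatenation product $\cdot$. Let $\pi_m$ be the projection to degree $m$ and $\pi^n$ the projection to $T^n(\mathbb R^d)=\bigoplus_{m\le n}(\mathbb R^d)^{\otimes m}$, which carries the truncated product $a\cdot_n b=\pi^n(a\cdot b)$. Let $\Delta$ be the coproduct dual to the shuffle product $\sqcup\!\sqcup$, i.e. the degree-wise linear map sending a word $w$ to $\sum u\otimes v$, the sum being over all ways of splitting $w$ into a subword $u$ and the complementary subword $v$. Let $$G=\{g\in T((\mathbb R^d))\setminus\{0\}:\Delta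 g=g\otimes g\},\qquad G^n=\{g\in T^n(\mathbb R^d)\setminus\{0\}:\Delta g=\pi^n(g\otimes g)\},$$ where, on tensors, $\pi^n$ is the projection to total degree at most $n$. In these groups the inverse is given by the antipode $i_1\cdots i_n\mapsto(-1)^n i_n\cdots i_1$. For $g\in G^n$ put $\|g\|_{G^n}=\sum_{m=1}^n\|\pi_m\log_n g\|^{1/m}$, where $\log_n$ is the logarithm of $(T^n(\mathbb R^d),\cdot_n)$ and $\|\cdot\|$ is the Euclidean norm in which the words are orthonormal. Consider the following four notions of a $d$-dimensional weakly geometric $\gamma$-Hölder rough path on $[0,T]$. 1. $\mathrm R^\gamma$ is the set of maps $X:[0,T]\to G^N$ with $X_0=\mathbf 1$ and $\sup_{s<t}\|X_{st}\|_{G^N}/|t-s|^\gamma<\infty$, where $X_{st}=X_s^{-1}\cdot_N X_t$. 2. $\bar{\mathrm R}^\gamma$ is the set of maps $\bar X:[0,T]\to G$ with $\bar X_0=\mathbf 1$ and $\sup_{s<t}\|\pi^n\bar X_{st}\|_{G^n}/|t-s|^\gamma<\infty$ for every $n\in\mathbb N$, where $\bar X_{st}=\bar X_s^{-1}\cdot\bar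 X_t$. 3. $\check{\mathrm R}^\gamma$ is the set of maps $\check X:[0,T]^2\to\langle\mathcal W^N\rangle^*$ such that, for all $s,u,t\in[0,T]$: (i) $\check X_{st}(\mathbf 1)=1$, and $\check X_{st}(w_1\sqcup\!\sqcup w_2)=\check X_{st}(w_1)\check X_{st}(w_2)$ for all words $w_1,w_2$ with $|w_1|+|w_2|\le N$; (ii) $\check X_{tt}(\mathbf 1)=1$ and $\check X_{tt}(w)=0$ for $w\in\mathcal W^N\setminus\{\mathbf 1\}$, and $\check X_{st}(w)=\sum_{w=w'w''}\check X_{su}(w')\check X_{ut}(w'')$ for all $w\in\mathcal W^N$, the sum being over all ways of cutting $w$ into a prefix $w'$ and a suffix $w''$; (iii) $\sup_{s\ne t}|\check X_{st}(w)|/|t-s|^{\gamma|w|}<\infty$ for all $w\in\mathcal W^N$. 4. $\hat{\mathrm R}^\gamma$ is the set of maps $\hat X:[0,T]^2\to\langle\mathcal W\rangle^*$ satisfying conditions (i)--(iii) for all words in $\mathcal W$, without any restriction on lengths. Then the maps $$I_1:\bar{\mathrm R}^\gamma\to\mathrm R^\gamma,\ (I_1\bar X)_t=\pi^N\bar X_t,\qquad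 I_2:\mathrm R^\gamma\to\check{\mathrm R}^\gamma,\ (I_2X)_{st}(w)=\langle w,X_{st}\rangle,\qquad I_3:\bar{\mathrm R}^\gamma\to\hat{\mathrm R}^\gamma,\ (I_3\bar X)_{st}(w)=\langle w,\bar X_{st}\rangle$$ are well-defined and bijective. -/

import Mathlib

namespace RoughPath

/-! ### Words, tensor series and the two dual Hopf algebras -/

/-- Words over the alphabet `{1, …, d}`; the empty word is `[]`, the length is `List.length`. -/
abbrev Word (d : ℕ) : Type := List (Fin d)

/-- Words of length at most `n`. -/
abbrev TruncWord (d n : ℕ) : Type := {w : Word d // w.length ≤ n}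

/-- The space `T((ℝ^d)) = ∏ₙ (ℝ^d)^{⊗n}` of tensor series. The word `i₁ ⋯ iₙ` stands for the basis
element `e_{i₁} ⊗ ⋯ ⊗ e_{iₙ}` of `(ℝ^d)^{⊗n}`, and a series is given by its family of coefficients
`g w = ⟨w, g⟩`. -/
abbrev TensorSeries (d : ℕ) : Type := Word d → ℝ

/-- The completed space `∏ₙ ⨁_{k+l=n} (ℝ^d)^{⊗k} ⊗ (ℝ^d)^{⊗l}`, in which the coproduct of a series
lives; the pair of words `(u, v)` stands for the basis element `u ⊗ v`. -/
abbrev TensorSeries₂ (d : ℕ) : Type := Word d → Word d → ℝ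

/-- The unit series `1`. -/
def one (d : ℕ) : TensorSeries d := fun w => if w = [] then 1 else 0

/-- The projection `π^n` to `T^n(ℝ^d) = ⨁_{m ≤ n} (ℝ^d)^{⊗m}`, regarded as a subspace of
`T((ℝ^d))`. -/
def trunc {d : ℕ} (n : ℕ) (g : TensorSeries d) : TensorSeries d :=
  fun w => if w.length ≤ n then g w else 0

/-- The projection to the part of total degree at most `n`. -/
def trunc₂ {d : ℕ} (n : ℕ) (G : TensorSeries₂ d) : TensorSeries₂ d :=
  fun u v => if u.length + v.length ≤ n then G u v else 0

/-- The concatenation (tensor) product of tensor series. -/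
def concat {d : ℕ} (a b : TensorSeries d) : TensorSeries d :=
  fun w => ∑ i ∈ Finset.range (w.length + 1), a (w.take i) * b (w.drop i)

/-- The product of the truncated tensor algebra `T^n(ℝ^d)`. -/
def concatTrunc {d : ℕ} (n : ℕ) (a b : TensorSeries d) : TensorSeries d :=
  trunc n (concat a b)

/-- The antipode, the linear map with `i₁ ⋯ iₙ ↦ (-1)ⁿ iₙ ⋯ i₁`. -/
def antipode {d : ℕ} (g : TensorSeries d) : TensorSeries d :=
  fun w => (-1) ^ w.length * g w.reverse

/-- The tensor `a ⊗ b` of two series. -/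
def tmul {d : ℕ} (a b : TensorSeries d) : TensorSeries₂ d :=
  fun u v => a u * b v

/-- All ways to split a word into a subword and the complementary subword, with multiplicity: one
pair for every set of positions of the word. -/
def deshuffles {α : Type} : List α → List (List α × List α)
  | [] => [([], [])]
  | a :: w => (deshuffles w).map (fun p => (a :: p.1, p.2)) ++
      (deshuffles w).map (fun p => (p.1, a :: p.2))

/-- The coproduct of the concatenation Hopf algebra, extended to series: linear in each degree, with
`w ↦ ∑ u ⊗ v` for a word `w`, the sum being over all splittings `(u, v)` of `w`. -/
def coprod {d : ℕ} (g : TensorSeries d) : TensorSeries₂ d :=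
  fun u v => ∑ w : Fin (u.length + v.length) → Fin d,
    g (List.ofFn w) * ((deshuffles (List.ofFn w)).count (u, v) : ℝ)

/-- All shuffles of two words, with multiplicity. -/
def shuffles {α : Type} : List α → List α → List (List α)
  | [], v => [v]
  | a :: u, [] => [a :: u]
  | a :: u, b :: v => (shuffles u (b :: v)).map (fun w => a :: w) ++
      (shuffles (a :: u) v).map (fun w => b :: w)
termination_by u v => u.length + v.length

/-- The shuffle product of two words, an element of the free vector space on words. -/
noncomputable def shuffle {d : ℕ} (u v : Word d) : Word d →₀ ℝ :=
  ((shuffles u v).map (fun w => Finsupp.single w (1 : ℝ))).sum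

/-- The group of group-like tensor series. -/
def grpSeries (d : ℕ) : Set (TensorSeries d) :=
  {g | g ≠ 0 ∧ coprod g = tmul g g}

/-- The group of truncated group-like elements of `T^n(ℝ^d)`. -/
def grpTrunc (n d : ℕ) : Set (TensorSeries d) :=
  {g | trunc n g = g ∧ g ≠ 0 ∧ coprod g = trunc₂ n (tmul g g)}

/-! ### The homogeneous norm -/

/-- Powers in the truncated tensor algebra. -/
def powTrunc {d : ℕ} (n : ℕ) (u : TensorSeries d) : ℕ → TensorSeries d
  | 0 => one d
  | k + 1 => concatTrunc n u (powTrunc n u k)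

/-- The logarithm `∑_{k ≥ 1} (-1)^{k-1} u^k / k` of `g = 1 + u` in the truncated tensor algebra. If
`u` has no constant term, then `u^k = 0` for `k > n`. -/
noncomputable def logTrunc {d : ℕ} (n : ℕ) (g : TensorSeries d) : TensorSeries d :=
  ∑ k ∈ Finset.Icc 1 n, ((-1 : ℝ) ^ (k - 1) / (k : ℝ)) • powTrunc n (g - one d) k

/-- The Euclidean norm of the component of degree `m`. -/
noncomputable def levelNorm {d : ℕ} (m : ℕ) (l : TensorSeries d) : ℝ :=
  Real.sqrt (∑ w : Fin m → Fin d, l (List.ofFn w) ^ 2)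

/-- The homogeneous norm `∑_{m=1}^n ‖π_m log g‖^{1/m}` on the truncated group. -/
noncomputable def grpNorm {d : ℕ} (n : ℕ) (g : TensorSeries d) : ℝ :=
  ∑ m ∈ Finset.Icc 1 n, levelNorm m (logTrunc n g) ^ (1 / (m : ℝ))

/-! ### The four definitions of a weakly geometric rough path -/

/-- The increment `X_{st} = X_s⁻¹ ⊗ X_t`; the inverse of a group-like element is its antipode. -/
def incr {d : ℕ} {T : ℝ} (X : Set.Icc (0 : ℝ) T → TensorSeries d) (s t : Set.Icc (0 : ℝ) T) :
    TensorSeries d :=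
  concat (antipode (X s)) (X t)

/-- The increment `X_{st} = X_s⁻¹ ⊗ₙ X_t` in the truncated group. -/
def incrTrunc {d : ℕ} {T : ℝ} (n : ℕ) (X : Set.Icc (0 : ℝ) T → TensorSeries d)
    (s t : Set.Icc (0 : ℝ) T) : TensorSeries d :=
  concatTrunc n (antipode (X s)) (X t)

/-- The integer part of `1/γ`. -/
noncomputable def level (γ : ℝ) : ℕ := ⌊1 / γ⌋₊

/-- Paths in the truncated group of level `⌊1/γ⌋`. -/
def TruncPaths (γ T : ℝ) (d : ℕ) : Set (Set.Icc (0 : ℝ) T → TensorSeries d) :=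
  {X | (∀ t, X t ∈ grpTrunc (level γ) d) ∧
    (∀ t : Set.Icc (0 : ℝ) T, (t : ℝ) = 0 → X t = one d) ∧
    ∃ C : ℝ, ∀ s t : Set.Icc (0 : ℝ) T, s < t →
      grpNorm (level γ) (incrTrunc (level γ) X s t) / |(t : ℝ) - s| ^ γ ≤ C}

/-- Paths in the group of group-like tensor series. -/
def SeriesPaths (γ T : ℝ) (d : ℕ) : Set (Set.Icc (0 : ℝ) T → TensorSeries d) :=
  {X | (∀ t, X t ∈ grpSeries d) ∧
    (∀ t : Set.Icc (0 : ℝ) T, (t : ℝ) = 0 → X t = one d) ∧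
    ∀ n : ℕ, ∃ C : ℝ, ∀ s t : Set.Icc (0 : ℝ) T, s < t →
      grpNorm n (trunc n (incr X s t)) / |(t : ℝ) - s| ^ γ ≤ C}

/-- Functionals on the span of the words of length at most `⌊1/γ⌋` (truncated shuffle characters),
indexed by two times. A shuffle `w₁ ⧢ w₂` with `|w₁| + |w₂| ≤ ⌊1/γ⌋` is supported on such words, and
`Finsupp.subtypeDomain` regards it as an element of their span. -/
def TruncCharacters (γ T : ℝ) (d : ℕ) :
    Set (Set.Icc (0 : ℝ) T → Set.Icc (0 : ℝ) T →
      Module.Dual ℝ (TruncWord d (level γ) →₀ ℝ)) :=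
  {X | (∀ s t, X s t (Finsupp.single ⟨[], Nat.zero_le _⟩ 1) = 1 ∧
      ∀ w₁ w₂ : TruncWord d (level γ), w₁.1.length + w₂.1.length ≤ level γ →
        X s t ((shuffle w₁.1 w₂.1).subtypeDomain (fun w => w.length ≤ level γ)) =
          X s t (Finsupp.single w₁ 1) * X s t (Finsupp.single w₂ 1)) ∧
    ((∀ t, X t t = Finsupp.lapply ⟨[], Nat.zero_le _⟩) ∧
      ∀ s u t, ∀ w : TruncWord d (level γ),
        X s t (Finsupp.single w 1) = ∑ i ∈ Finset.range (w.1.length + 1),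
          X s u (Finsupp.single ⟨w.1.take i, (w.1.length_take_le' i).trans w.2⟩ 1) *
          X u t (Finsupp.single
            ⟨w.1.drop i, (List.length_drop.trans_le (Nat.sub_le _ _)).trans w.2⟩ 1)) ∧
    ∀ w : TruncWord d (level γ), ∃ C : ℝ, ∀ s t : Set.Icc (0 : ℝ) T, s ≠ t →
      |X s t (Finsupp.single w 1)| / |(t : ℝ) - s| ^ (γ * (w.1.length : ℝ)) ≤ C}

/-- Functionals on the span of all words (shuffle characters), indexed by two times. -/
def Characters (γ T : ℝ) (d : ℕ) :
    Set (Set.Icc (0 : ℝ) T → Set.Icc (0 : ℝ) T → Module.Dual ℝ (Word d →₀ ℝ)) :=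
  {X | (∀ s t, X s t (Finsupp.single [] 1) = 1 ∧
      ∀ w₁ w₂ : Word d,
        X s t (shuffle w₁ w₂) = X s t (Finsupp.single w₁ 1) * X s t (Finsupp.single w₂ 1)) ∧
    ((∀ t, X t t = Finsupp.lapply []) ∧
      ∀ s u t, ∀ w : Word d,
        X s t (Finsupp.single w 1) = ∑ i ∈ Finset.range (w.length + 1),
          X s u (Finsupp.single (w.take i) 1) * X u t (Finsupp.single (w.drop i) 1)) ∧
    ∀ w : Word d, ∃ C : ℝ, ∀ s t : Set.Icc (0 : ℝ) T, s ≠ t →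
      |X s t (Finsupp.single w 1)| / |(t : ℝ) - s| ^ (γ * (w.length : ℝ)) ≤ C}

/-! ### The maps between them -/

/-- Truncation of a path at level `⌊1/γ⌋`. -/
noncomputable def I₁ (γ T : ℝ) (d : ℕ) (X : Set.Icc (0 : ℝ) T → TensorSeries d) :
    Set.Icc (0 : ℝ) T → TensorSeries d :=
  fun t => trunc (level γ) (X t)

/-- Pairing of the increments of a truncated path with words: `w ↦ ⟨w, X_{st}⟩`, extended
linearly. -/
noncomputable def I₂ (γ T : ℝ) (d : ℕ) (X : Set.Icc (0 : ℝ) T → TensorSeries d) :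
    Set.Icc (0 : ℝ) T → Set.Icc (0 : ℝ) T → Module.Dual ℝ (TruncWord d (level γ) →₀ ℝ) :=
  fun s t => Finsupp.linearCombination ℝ
    (fun w : TruncWord d (level γ) => incrTrunc (level γ) X s t w.1)

/-- Pairing of the increments of a path of tensor series with words: `w ↦ ⟨w, X_{st}⟩`, extended
linearly. -/
noncomputable def I₃ (T : ℝ) (d : ℕ) (X : Set.Icc (0 : ℝ) T → TensorSeries d) :
    Set.Icc (0 : ℝ) T → Set.Icc (0 : ℝ) T → Module.Dual ℝ (Word d →₀ ℝ) :=
  fun s t => Finsupp.linearCombination ℝ (fun w : Word d => incr X s t w)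

end RoughPath

/-! All four notions reduce to one object: a two-parameter family `x s t` of series that is
multiplicative on shuffles, satisfies Chen's relation and has word coefficients of order `|t - s| ^
(γ |w|)`, up to some degree or in every degree (`IsRough`). Three dictionaries give the reduction.
Group-like elements are the shuffle characters (`mem_grpSeries_iff`, `mem_grpTrunc_iff`), because
the coproduct is dual to the shuffle product. Homogeneous norm bounds are coefficient bounds
(`isBigO_grpNorm_iff`), because the logarithm is triangular in the degree. Paths and their
increments determine each other once the path starts at the unit (`incr_of_eq_one`,
`IsRough.agreeTo_incr`). This settles `I₂` and `I₃`.

For `I₁` the point is that the levels above `N = ⌊1/γ⌋` are determined by those up to `N`. In a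
product of series with constant term one, the top degree enters additively (`concat_eq_add`), and
for `n ≥ N` the Hölder exponent `γ (n + 1)` exceeds one. Hence two extensions differ by an additive
function that is too regular to be nonzero (`additive_eq_zero`), which is uniqueness. For existence,
the product of truncated increments gives a cocycle in degree `n + 1`, which sewing
(`exists_sewing`) corrects to a solution of Chen's relation with the right bound
(`IsRough.exists_extension`). The same vanishing principle makes the new level a shuffle character
(`IsRough.succ`). -/

namespace RoughPath

open Filter Topology Asymptotics

variable {d : ℕ}

/-! ### The concatenation product -/

theorem concat_nil (a b : TensorSeries d) : concat a b [] = a [] * b [] := by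
  simp [concat]

theorem concat_cons (a b : TensorSeries d) (i : Fin d) (w : Word d) :
    concat a b (i :: w) = concat (fun v => a (i :: v)) b w + a [] * b (i :: w) := by
  simp [concat, Finset.sum_range_succ' _ (w.length + 1)]

theorem concat_add_left (a b c : TensorSeries d) (w : Word d) :
    concat (fun v => a v + b v) c w = concat a c w + concat b c w := by
  simp [concat, add_mul, Finset.sum_add_distrib]

theorem concat_mul_left (r : ℝ) (a b : TensorSeries d) (w : Word d) :
    concat (fun v => r * a v) b w = r * concat a b w := by
  simp [concat, mul_assoc, Finset.mul_sum]

theorem concat_assoc (a b c : TensorSeries d) :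
    concat (concat a b) c = concat a (concat b c) := by
  funext w
  induction w generalizing a b with
  | nil => simp [concat_nil, mul_assoc]
  | cons i w ih =>
    simp only [concat_cons, concat_nil, concat_add_left, concat_mul_left, ih]
    ring

theorem one_nil : one d [] = 1 := by simp [one]

theorem one_cons (i : Fin d) (w : Word d) : one d (i :: w) = 0 := by simp [one]

theorem zero_concat (a : TensorSeries d) (w : Word d) : concat (fun _ => 0) a w = 0 := by
  simp [concat]

theorem one_concat (a : TensorSeries d) : concat (one d) a = a := by
  funext w
  cases w <;> simp [concat_nil, concat_cons, one_nil, one_cons, zero_concat]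

theorem concat_one (a : TensorSeries d) : concat a (one d) = a := by
  funext w
  induction w generalizing a with
  | nil => simp [concat_nil, one_nil]
  | cons i w ih => simp [concat_cons, one_cons, ih]

/-- Two series have the same coefficients in degrees at most `n`. -/
def AgreeTo (n : ℕ) (a b : TensorSeries d) : Prop := ∀ w : Word d, w.length ≤ n → a w = b w

theorem AgreeTo.refl (n : ℕ) (a : TensorSeries d) : AgreeTo n a a := fun _ _ => rfl

theorem AgreeTo.symm {n : ℕ} {a b : TensorSeries d} (h : AgreeTo n a b) : AgreeTo n b a :=
  fun w hw => (h w hw).symm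

theorem AgreeTo.trans {n : ℕ} {a b c : TensorSeries d} (h : AgreeTo n a b) (h' : AgreeTo n b c) :
    AgreeTo n a c :=
  fun w hw => (h w hw).trans (h' w hw)

theorem AgreeTo.mono {m n : ℕ} {a b : TensorSeries d} (h : AgreeTo n a b) (hm : m ≤ n) :
    AgreeTo m a b :=
  fun w hw => h w (hw.trans hm)

theorem AgreeTo.concat {n : ℕ} {a a' b b' : TensorSeries d} (h : AgreeTo n a a')
    (h' : AgreeTo n b b') : AgreeTo n (concat a b) (concat a' b') := by
  intro w hw
  refine Finset.sum_congr rfl fun i _ => ?_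
  rw [h _ ((w.length_take_le' i).trans hw),
    h' _ ((List.length_drop.trans_le (Nat.sub_le _ _)).trans hw)]

theorem AgreeTo.antipode {n : ℕ} {a a' : TensorSeries d} (h : AgreeTo n a a') :
    AgreeTo n (antipode a) (antipode a') := by
  intro w hw
  simp only [RoughPath.antipode]
  rw [h _ (by simpa using hw)]

theorem agreeTo_trunc (n : ℕ) (a : TensorSeries d) : AgreeTo n (trunc n a) a :=
  fun w hw => by simp [trunc, hw]

theorem trunc_eq_trunc_iff {n : ℕ} {a b : TensorSeries d} :
    trunc n a = trunc n b ↔ AgreeTo n a b := by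
  refine ⟨fun h w hw => ?_, fun h => ?_⟩
  · simpa [trunc, hw] using congrFun h w
  · funext w
    by_cases hw : w.length ≤ n
    · simp [trunc, hw, h w hw]
    · simp [trunc, hw]

theorem trunc_trunc (n : ℕ) (a : TensorSeries d) : trunc n (trunc n a) = trunc n a :=
  trunc_eq_trunc_iff.2 (agreeTo_trunc n a)

/-! ### Pairing of a series with the shuffle product of two words -/

/-- The pairing `⟨u ⧢ v, g⟩`. -/
def shufflePair (g : TensorSeries d) (u v : Word d) : ℝ := ((shuffles u v).map g).sum

theorem shufflePair_nil_left (g : TensorSeries d) (v : Word d) : shufflePair g [] v = g v := by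
  simp [shufflePair, shuffles]

theorem shufflePair_nil_right (g : TensorSeries d) (u : Word d) : shufflePair g u [] = g u := by
  cases u <;> simp [shufflePair, shuffles]

theorem shufflePair_cons_cons (g : TensorSeries d) (a b : Fin d) (u v : Word d) :
    shufflePair g (a :: u) (b :: v) =
      shufflePair (fun w => g (a :: w)) u (b :: v) +
        shufflePair (fun w => g (b :: w)) (a :: u) v := by
  simp [shufflePair, shuffles, Function.comp_def]

theorem length_of_mem_shuffles {u v w : Word d} (h : w ∈ shuffles u v) :
    w.length = u.length + v.length := by
  induction w generalizing u v with
  | nil =>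
    rcases u with _ | ⟨a, u⟩ <;> rcases v with _ | ⟨b, v⟩ <;> simp [shuffles] at h ⊢
  | cons c w ih =>
    rcases u with _ | ⟨a, u⟩ <;> rcases v with _ | ⟨b, v⟩
    · simp [shuffles] at h
    · simp [shuffles] at h; simp [h]
    · simp [shuffles] at h; simp [h]
    · simp only [shuffles, List.mem_append, List.mem_map, List.cons.injEq] at h
      rcases h with ⟨w', hw', -, rfl⟩ | ⟨w', hw', -, rfl⟩
      · have := ih hw'; simp at this ⊢; omega
      · have := ih hw'; simp at this ⊢; omega

theorem shufflePair_congr {g g' : TensorSeries d} {u v : Word d}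
    (h : ∀ w : Word d, w.length = u.length + v.length → g w = g' w) :
    shufflePair g u v = shufflePair g' u v := by
  unfold shufflePair
  rw [List.map_congr_left fun w hw => h w (length_of_mem_shuffles hw)]

theorem shufflePair_add (g g' : TensorSeries d) (u v : Word d) :
    shufflePair (fun w => g w + g' w) u v = shufflePair g u v + shufflePair g' u v := by
  simp [shufflePair, List.sum_map_add]

theorem shufflePair_mul (r : ℝ) (g : TensorSeries d) (u v : Word d) :
    shufflePair (fun w => r * g w) u v = r * shufflePair g u v := by
  simp [shufflePair, List.sum_map_mul_left]

theorem count_cons_map_cons (a c : Fin d) (w : Word d) (l : List (Word d)) :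
    (l.map (fun w => a :: w)).count (c :: w) = if a = c then l.count w else 0 := by
  split_ifs with h
  · subst h
    exact List.count_map_of_injective l _ (fun _ _ h => by simpa using h) w
  · rw [List.count_eq_zero]
    simp [h]

theorem count_nil_map_cons (a : Fin d) (l : List (Word d)) :
    (l.map (fun w => a :: w)).count [] = 0 := by
  rw [List.count_eq_zero]
  simp

/-- The first letter of `w` must be the first letter of `u` or of `v`, and removing it gives the
same recursion on both sides. -/
theorem count_shuffles (u v w : Word d) :
    (deshuffles w).count (u, v) = (shuffles u v).count w := by
  induction w generalizing u v with
  | nil =>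
    rcases u with _ | ⟨a, u⟩ <;> rcases v with _ | ⟨b, v⟩ <;>
      simp [shuffles, deshuffles, count_nil_map_cons]
  | cons c w ih =>
    have hl : ((deshuffles w).map (fun p => (c :: p.1, p.2))).count (u, v) =
        match u with
        | [] => 0
        | a :: u => if a = c then (deshuffles w).count (u, v) else 0 := by
      rcases u with _ | ⟨a, u⟩
      · simp [List.count_eq_zero]
      · by_cases h : a = c
        · subst h
          simp only [if_true]
          exact List.count_map_of_injective (deshuffles w) (fun p => (a :: p.1, p.2))
            (fun p q h => by simpa [Prod.ext_iff] using h) (u, v)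
        · simp only [h, if_false]
          rw [List.count_eq_zero]
          simp [Ne.symm h]
    have hr : ((deshuffles w).map (fun p => (p.1, c :: p.2))).count (u, v) =
        match (generalizing := false) v with
        | [] => 0
        | b :: v => if b = c then (deshuffles w).count (u, v) else 0 := by
      rcases v with _ | ⟨b, v⟩
      · simp [List.count_eq_zero]
      · by_cases h : b = c
        · subst h
          simp only [if_true]
          exact List.count_map_of_injective (deshuffles w) (fun p => (p.1, b :: p.2))
            (fun p q h => by simpa [Prod.ext_iff] using h) (u, v)
        · simp only [h, if_false]
          rw [List.count_eq_zero]
          simp [Ne.symm h]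
    rw [deshuffles, List.count_append, hl, hr]
    rcases u with _ | ⟨a, u⟩ <;> rcases v with _ | ⟨b, v⟩
    · simp [shuffles]
    · simp only [ih, shuffles, List.count_singleton]
      by_cases h : b = c <;> simp [h]
    · simp only [ih, shuffles, List.count_singleton]
      by_cases h : a = c <;> cases u <;> simp [h, shuffles, List.count_singleton]
    · simp [ih, shuffles, count_cons_map_cons]

theorem sum_mul_count {n : ℕ} (g : TensorSeries d) (l : List (Word d))
    (hl : ∀ x ∈ l, x.length = n) :
    ∑ w : Fin n → Fin d, g (List.ofFn w) * (l.count (List.ofFn w) : ℝ) = (l.map g).sum := by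
  induction l with
  | nil => simp
  | cons x l ih =>
    obtain ⟨rfl, hl⟩ := List.forall_mem_cons.1 hl
    have hx : ∀ w : Fin x.length → Fin d, x = List.ofFn w ↔ x.get = w := by
      intro w
      constructor
      · intro h
        apply List.ofFn_injective
        simpa using h
      · rintro rfl
        simp
    simp only [List.count_cons, Nat.cast_add, mul_add, Finset.sum_add_distrib, ih hl, List.map_cons,
      List.sum_cons, beq_iff_eq, hx]
    simp [add_comm]

/-- The duality between coproduct and shuffle product; it lets the remaining arguments work with the
recursive `shufflePair`. -/
theorem coprod_eq_shufflePair (g : TensorSeries d) (u v : Word d) :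
    coprod g u v = shufflePair g u v := by
  unfold coprod
  simp only [count_shuffles]
  exact sum_mul_count g _ fun w hw => length_of_mem_shuffles hw

/-- The product of functions of two words dual to the deconcatenation of both words. -/
def concat₂ (F G : TensorSeries₂ d) : TensorSeries₂ d := fun u v =>
  ∑ i ∈ Finset.range (u.length + 1), ∑ j ∈ Finset.range (v.length + 1),
    F (u.take i) (v.take j) * G (u.drop i) (v.drop j)

/-- This is the bialgebra compatibility of shuffle and deconcatenation. Peeling first letters splits
both sides by whether the left factor is empty and, if not, by which word supplies its first letter.
-/
theorem shufflePair_concat (f g : TensorSeries d) (u v : Word d) :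
    shufflePair (concat f g) u v = concat₂ (shufflePair f) (shufflePair g) u v := by
  induction hn : u.length + v.length using Nat.strong_induction_on generalizing u v f g with
  | _ n ih =>
  rcases u with _ | ⟨a, u⟩
  · simp [concat₂, shufflePair_nil_left, concat]
  rcases v with _ | ⟨b, v⟩
  · simp [concat₂, shufflePair_nil_right, concat]
  subst hn
  have h1 := fun f g => ih _ (by simp) f g u (b :: v) rfl
  have h2 := fun f g => ih _ (by simp) f g (a :: u) v rfl
  simp only [shufflePair_cons_cons, concat_cons, shufflePair_add, shufflePair_mul, h1, h2]
  simp only [concat₂, List.length_cons, Finset.sum_range_succ' _ (u.length + 1),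
    Finset.sum_range_succ' _ (v.length + 1), List.take_succ_cons, List.drop_succ_cons,
    List.take_zero, List.drop_zero, shufflePair_nil_left, shufflePair_nil_right,
    shufflePair_cons_cons, add_mul, Finset.sum_add_distrib]
  ring

theorem concat₂_tmul (a b f g : TensorSeries d) :
    concat₂ (tmul a b) (tmul f g) = tmul (concat a f) (concat b g) := by
  funext u v
  simp only [concat₂, tmul, concat, Finset.sum_mul_sum]
  exact Finset.sum_congr rfl fun i _ => Finset.sum_congr rfl fun j _ => by ring

/-- The shuffle recursion read from the last letter, which is what word reversal produces from the
first-letter recursion. -/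
theorem shufflePair_append_append (g : TensorSeries d) (a b : Fin d) (u v : Word d) :
    shufflePair g (u ++ [a]) (v ++ [b]) =
      shufflePair (fun w => g (w ++ [a])) u (v ++ [b]) +
        shufflePair (fun w => g (w ++ [b])) (u ++ [a]) v := by
  induction hn : u.length + v.length using Nat.strong_induction_on generalizing u v g with
  | _ n ih =>
  subst hn
  rcases u with _ | ⟨c, u⟩ <;> rcases v with _ | ⟨e, v⟩
  · simp [shufflePair_cons_cons, shufflePair_nil_left, shufflePair_nil_right, add_comm]
  · have h := fun g => ih _ (by simp) g [] v rfl
    simp only [List.nil_append, List.cons_append] at h ⊢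
    simp only [shufflePair_cons_cons, h, shufflePair_nil_left, List.cons_append]
    ring
  · have h := fun g => ih _ (by simp) g u [] rfl
    simp only [List.nil_append, List.cons_append] at h ⊢
    simp only [shufflePair_cons_cons, h, shufflePair_nil_right, List.cons_append]
    ring
  · have h1 := fun g => ih _ (by simp) g u (e :: v) rfl
    have h2 := fun g => ih _ (by simp) g (c :: u) v rfl
    simp only [List.cons_append] at h1 h2 ⊢
    simp only [shufflePair_cons_cons, h1, h2, List.cons_append]
    ring

theorem shufflePair_reverse (g : TensorSeries d) (u v : Word d) :
    shufflePair (fun w => g w.reverse) u v = shufflePair g u.reverse v.reverse := by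
  induction hn : u.length + v.length using Nat.strong_induction_on generalizing u v g with
  | _ n ih =>
  subst hn
  rcases u with _ | ⟨a, u⟩
  · simp [shufflePair_nil_left]
  rcases v with _ | ⟨b, v⟩
  · simp [shufflePair_nil_right]
  have h1 := ih _ (by simp) (fun w => g (w ++ [a])) u (b :: v) rfl
  have h2 := ih _ (by simp) (fun w => g (w ++ [b])) (a :: u) v rfl
  simp only [List.reverse_cons] at h1 h2 ⊢
  rw [shufflePair_append_append, ← h1, ← h2, shufflePair_cons_cons]
  simp

/-! ### Characters of the shuffle algebra up to a given degree -/

/-- The series `g` is multiplicative on shuffles of words of total length at most `n`. -/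
def IsChar (n : ℕ) (g : TensorSeries d) : Prop :=
  g [] = 1 ∧ ∀ u v : Word d, u.length + v.length ≤ n → shufflePair g u v = g u * g v

theorem IsChar.congr {n : ℕ} {g g' : TensorSeries d} (h : IsChar n g) (hg : AgreeTo n g g') :
    IsChar n g' := by
  refine ⟨(hg [] (by simp)).symm.trans h.1, fun u v huv => ?_⟩
  rw [← hg u (by omega), ← hg v (by omega), ← h.2 u v huv]
  exact shufflePair_congr fun w hw => (hg w (by omega)).symm

theorem IsChar.mono {m n : ℕ} {g : TensorSeries d} (h : IsChar n g) (hm : m ≤ n) : IsChar m g :=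
  ⟨h.1, fun u v huv => h.2 u v (huv.trans hm)⟩

theorem concat₂_congr {n : ℕ} {F F' G G' : TensorSeries₂ d}
    (hF : ∀ u v : Word d, u.length + v.length ≤ n → F u v = F' u v)
    (hG : ∀ u v : Word d, u.length + v.length ≤ n → G u v = G' u v)
    {u v : Word d} (huv : u.length + v.length ≤ n) : concat₂ F G u v = concat₂ F' G' u v := by
  refine Finset.sum_congr rfl fun i _ => Finset.sum_congr rfl fun j _ => ?_
  have h1 := u.length_take_le' i
  have h2 := v.length_take_le' j
  rw [hF _ _ (by omega), hG _ _ (by simp only [List.length_drop]; omega)]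

theorem IsChar.concat {n : ℕ} {f g : TensorSeries d} (hf : IsChar n f) (hg : IsChar n g) :
    IsChar n (concat f g) := by
  refine ⟨by simp [concat_nil, hf.1, hg.1], fun u v huv => ?_⟩
  rw [shufflePair_concat, concat₂_congr (F' := tmul f f) (G' := tmul g g) hf.2 hg.2 huv,
    concat₂_tmul]
  rfl

/-- All shuffles of `u` and `v` have the same length, so the sign is a constant factor, and reversal
respects shuffles. -/
theorem IsChar.antipode {n : ℕ} {g : TensorSeries d} (hg : IsChar n g) :
    IsChar n (antipode g) := by
  refine ⟨by simp [RoughPath.antipode, hg.1], fun u v huv => ?_⟩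
  have h : shufflePair (RoughPath.antipode g) u v =
      shufflePair (fun w => (-1) ^ (u.length + v.length) * g w.reverse) u v :=
    shufflePair_congr fun w hw => by rw [← hw]; rfl
  rw [h, shufflePair_mul, shufflePair_reverse, hg.2 _ _ (by simpa using huv)]
  simp only [RoughPath.antipode]
  ring

theorem antipode_antipode (g : TensorSeries d) : antipode (antipode g) = g := by
  funext w
  simp [antipode, ← mul_assoc, ← mul_pow]

theorem antipode_one : antipode (one d) = one d := by
  funext w
  cases w <;> simp [antipode, one]

/-- A telescoping sum. With `b` the first letter of `w`, the term `i = 0` splits into shuffles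
starting with `a` and with `b`; by induction with `b` in place of `a` and `a :: u` in place of `u`,
the remaining terms cancel the second kind. -/
theorem alternating_sum_shufflePair (g : TensorSeries d) (a : Fin d) (u w : Word d) :
    ∑ i ∈ Finset.range (w.length + 1),
        (-1) ^ i * shufflePair g ((w.take i).reverse ++ a :: u) (w.drop i) =
      shufflePair (fun v => g (a :: v)) u w := by
  induction w generalizing a u with
  | nil => simp [shufflePair_nil_right]
  | cons b w ih =>
    have h := ih b (a :: u)
    rw [List.length_cons, Finset.sum_range_succ']
    simp only [List.take_succ_cons, List.reverse_cons, List.append_assoc, List.singleton_append,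
      List.drop_succ_cons, pow_succ, mul_neg, mul_one, neg_mul, Finset.sum_neg_distrib, h]
    simp [shufflePair_cons_cons]

/-- Multiplicativity turns each product of values on a reversed prefix and a suffix into a shuffle
pairing, and the resulting alternating sum telescopes. -/
theorem IsChar.antipode_concat {n : ℕ} {g : TensorSeries d} (hg : IsChar n g) :
    AgreeTo n (RoughPath.concat (RoughPath.antipode g) g) (one d) := by
  intro w hw
  have h : RoughPath.concat (RoughPath.antipode g) g w =
      ∑ i ∈ Finset.range (w.length + 1),
        (-1) ^ i * shufflePair g (w.take i).reverse (w.drop i) := by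
    refine Finset.sum_congr rfl fun i hi => ?_
    have hi' : i ≤ w.length := by simpa [Nat.lt_succ_iff] using hi
    rw [hg.2 _ _ (by simp; omega)]
    simp [RoughPath.antipode, hi', mul_assoc]
  rw [h]
  rcases w with _ | ⟨a, w⟩
  · simp [shufflePair_nil_left, one_nil, hg.1]
  · rw [List.length_cons, Finset.sum_range_succ']
    simp only [List.take_succ_cons, List.reverse_cons, List.drop_succ_cons, pow_succ, mul_neg,
      mul_one, neg_mul, Finset.sum_neg_distrib, alternating_sum_shufflePair]
    simp [shufflePair_nil_left, one_cons]

theorem IsChar.concat_antipode {n : ℕ} {g : TensorSeries d} (hg : IsChar n g) :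
    AgreeTo n (RoughPath.concat g (RoughPath.antipode g)) (one d) := by
  simpa [antipode_antipode] using hg.antipode.antipode_concat

theorem isChar_of_ne_zero {n : ℕ} {g : TensorSeries d} (hg : ∃ w, w.length ≤ n ∧ g w ≠ 0)
    (h : ∀ u v : Word d, u.length + v.length ≤ n → shufflePair g u v = g u * g v) :
    IsChar n g := by
  refine ⟨?_, h⟩
  obtain ⟨w, hw, hg⟩ := hg
  have := h w [] (by simpa using hw)
  rw [shufflePair_nil_right] at this
  exact mul_left_cancel₀ hg (by rw [← this, mul_one])

theorem mem_grpSeries_iff {g : TensorSeries d} : g ∈ grpSeries d ↔ ∀ n, IsChar n g := by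
  constructor
  · rintro ⟨h0, h⟩ n
    have h' : ∀ u v : Word d, shufflePair g u v = g u * g v := fun u v => by
      rw [← coprod_eq_shufflePair, h]; rfl
    obtain ⟨w, hw⟩ := Function.ne_iff.1 h0
    exact ⟨(isChar_of_ne_zero ⟨w, le_rfl, hw⟩ fun u v _ => h' u v).1, fun u v _ => h' u v⟩
  · intro h
    refine ⟨fun h0 => by simpa [h0] using (h 0).1, ?_⟩
    funext u v
    rw [coprod_eq_shufflePair]
    exact (h _).2 u v le_rfl

theorem mem_grpTrunc_iff {n : ℕ} {g : TensorSeries d} :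
    g ∈ grpTrunc n d ↔ trunc n g = g ∧ IsChar n g := by
  constructor
  · rintro ⟨ht, h0, h⟩
    refine ⟨ht, isChar_of_ne_zero ?_ fun u v huv => ?_⟩
    · obtain ⟨w, hw⟩ := Function.ne_iff.1 h0
      refine ⟨w, by_contra fun hn => hw ?_, hw⟩
      rw [← ht]
      simp [trunc, hn]
    · rw [← coprod_eq_shufflePair, h]
      simp [trunc₂, huv, tmul]
  · rintro ⟨ht, h⟩
    refine ⟨ht, fun h0 => by simpa [h0] using h.1, ?_⟩
    funext u v
    rw [coprod_eq_shufflePair]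
    by_cases huv : u.length + v.length ≤ n
    · simp [trunc₂, huv, tmul, h.2 u v huv]
    -- Every shuffle here is longer than `n`, where `g` vanishes; writing zero as `0 * g w` lets
    -- `shufflePair_mul` conclude.
    · rw [← ht, shufflePair_congr (g' := fun w => 0 * g w) fun w hw => by simp [trunc, hw, huv],
        shufflePair_mul]
      simp [trunc₂, huv]

/-! ### Sewing -/

/-- Bisecting an interval improves the constant by the factor `2 * (1 / 2) ^ θ < 1`, so iterated
bisection sends the bound to zero. -/
theorem additive_eq_zero {T C θ : ℝ} (hθ : 1 < θ)
    {E : Set.Icc (0 : ℝ) T → Set.Icc (0 : ℝ) T → ℝ} (hadd : ∀ s u t, E s t = E s u + E u t)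
    (hE : ∀ s t, s ≤ t → |E s t| ≤ C * |(t : ℝ) - s| ^ θ) (s t : Set.Icc (0 : ℝ) T) :
    E s t = 0 := by
  have hle : ∀ s t, s ≤ t → E s t = 0 := by
    set r : ℝ := 2 * (1 / 2) ^ θ with hr
    have hr0 : 0 ≤ r := by positivity
    have hr1 : r < 1 := by
      have : (1 / 2 : ℝ) ^ θ < (1 / 2) ^ (1 : ℝ) :=
        Real.rpow_lt_rpow_of_exponent_gt (by norm_num) (by norm_num) hθ
      rw [Real.rpow_one] at this
      linarith
    have key : ∀ k : ℕ, ∀ s t, s ≤ t → |E s t| ≤ C * r ^ k * |(t : ℝ) - s| ^ θ := by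
      intro k
      induction k with
      | zero => simpa using hE
      | succ k ih =>
        intro s t hst
        have hst' : (s : ℝ) ≤ t := hst
        let u : Set.Icc (0 : ℝ) T := ⟨((s : ℝ) + t) / 2, by
          have := s.2.1; have := t.2.1; constructor <;> linarith [s.2.2, t.2.2]⟩
        have hsu : s ≤ u := Subtype.coe_le_coe.1 (show (s : ℝ) ≤ ((s : ℝ) + t) / 2 by linarith)
        have hut : u ≤ t := Subtype.coe_le_coe.1 (show ((s : ℝ) + t) / 2 ≤ t by linarith)
        have h1 := ih s u hsu
        have h2 := ih u t hut
        have e1 : |(u : ℝ) - s| = 1 / 2 * |(t : ℝ) - s| := by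
          rw [show (u : ℝ) - s = 1 / 2 * ((t : ℝ) - s) by simp only [u]; ring, abs_mul]
          norm_num
        have e2 : |(t : ℝ) - u| = 1 / 2 * |(t : ℝ) - s| := by
          rw [show (t : ℝ) - u = 1 / 2 * ((t : ℝ) - s) by simp only [u]; ring, abs_mul]
          norm_num
        rw [e1, Real.mul_rpow (by norm_num) (abs_nonneg _)] at h1
        rw [e2, Real.mul_rpow (by norm_num) (abs_nonneg _)] at h2
        calc |E s t| ≤ |E s u| + |E u t| := by rw [hadd s u t]; exact abs_add_le _ _
          _ ≤ _ := add_le_add h1 h2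
          _ = C * r ^ (k + 1) * |(t : ℝ) - s| ^ θ := by rw [pow_succ, hr]; ring
    intro s t hst
    have hlim : Tendsto (fun k : ℕ => C * r ^ k * |(t : ℝ) - s| ^ θ) atTop (𝓝 0) := by
      simpa using ((tendsto_pow_atTop_nhds_zero_of_lt_one hr0 hr1).const_mul C).mul_const
        (|(t : ℝ) - s| ^ θ)
    exact abs_nonpos_iff.1 (ge_of_tendsto' hlim fun k => key k s t hst)
  rcases le_total s t with h | h
  · exact hle s t h
  · have h1 := hadd t s t
    have h2 := hle t t le_rfl
    rw [hle t s h] at h1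
    linarith

/-- Riemann sums of an almost additive function along a monotone sequence stay close to it. -/
theorem abs_sum_sub_le {α : Type*} [LinearOrder α] {ρ : α → ℝ} (hρ : Monotone ρ) {C θ : ℝ}
    (hθ : 1 < θ) (hC : 0 ≤ C) {A : α → α → ℝ}
    (hA : ∀ s u t, s ≤ u → u ≤ t → |A s t - A s u - A u t| ≤ C * (ρ t - ρ s) ^ θ)
    {τ : ℕ → α} (hτ : Monotone τ) (a b : ℕ) (hab : a ≤ b) :
    |∑ i ∈ Finset.Ico a b, A (τ i) (τ (i + 1)) - A (τ a) (τ b)| ≤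
      2 * C / (1 - 2 * (1 / 2) ^ θ) * (ρ (τ b) - ρ (τ a)) ^ θ := by
  have hr1 : 2 * (1 / 2 : ℝ) ^ θ < 1 := by
    have : (1 / 2 : ℝ) ^ θ < (1 / 2) ^ (1 : ℝ) :=
      Real.rpow_lt_rpow_of_exponent_gt (by norm_num) (by norm_num) hθ
    rw [Real.rpow_one] at this
    linarith
  set q : ℝ := (1 / 2 : ℝ) ^ θ with hq
  set K : ℝ := 2 * C / (1 - 2 * q) with hK
  have hK0 : 0 ≤ K := div_nonneg (by positivity) (by linarith)
  -- `K` is the fixed point of the induction: two pieces of at most half the length cost `K * q`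
  -- each, and the two splittings cost `C` each.
  have hKeq : 2 * K * q + 2 * C = K := by
    rw [hK]
    have : (1 - 2 * q) ≠ 0 := by linarith
    field_simp
    ring
  induction hn : b - a using Nat.strong_induction_on generalizing a b with
  | _ n ih =>
  subst hn
  have hmono : ∀ i j, i ≤ j → ρ (τ i) ≤ ρ (τ j) := fun i j h => hρ (hτ h)
  have hAA : ∀ s, A s s = 0 := by
    intro s
    have := hA s s s le_rfl le_rfl
    rw [sub_self (ρ s), Real.zero_rpow (by linarith), mul_zero] at this
    linarith [abs_nonpos_iff.1 this]
  rcases hab.eq_or_lt with rfl | hlt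
  · simpa [hAA] using mul_nonneg hK0 (Real.rpow_nonneg le_rfl θ)
  set L := ρ (τ b) - ρ (τ a) with hL
  have hL0 : 0 ≤ L := sub_nonneg.2 (hmono a b hab)
  classical
  -- The pivot is the last index before `b` in the first half. Then `[a, i]` and `[i + 1, b]` both
  -- have `ρ`-length at most `L / 2`, and the single step from `i` to `i + 1` needs no estimate.
  let P : ℕ → Prop := fun i => i < b ∧ ρ (τ i) ≤ ρ (τ a) + L / 2
  have hPa : P a := ⟨hlt, by linarith⟩
  set i := Nat.findGreatest P b with hi
  have hPi : P i := Nat.findGreatest_spec hab hPa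
  have hai : a ≤ i := Nat.le_findGreatest hab hPa
  have hib : i + 1 ≤ b := hPi.1
  have hi1 : ρ (τ a) + L / 2 ≤ ρ (τ (i + 1)) := by
    rcases hib.eq_or_lt with h | h
    · rw [h]; linarith
    · have := Nat.findGreatest_is_greatest (P := P) (n := b) (k := i + 1) (by omega) hib
      by_contra h'
      exact this ⟨h, by linarith⟩
  have half : ∀ x : ℝ, 0 ≤ x → x ≤ 1 / 2 * L → K * x ^ θ ≤ K * q * L ^ θ := by
    intro x hx hxL
    rw [mul_assoc, hq, ← Real.mul_rpow (by norm_num) hL0]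
    exact mul_le_mul_of_nonneg_left (Real.rpow_le_rpow hx hxL (by linarith)) hK0
  have b1 := (ih (i - a) (by omega) a i hai rfl).trans
    (half _ (sub_nonneg.2 (hmono a i hai)) (by linarith [hPi.2]))
  have b2 := (ih (b - (i + 1)) (by omega) (i + 1) b hib rfl).trans
    (half _ (sub_nonneg.2 (hmono _ b hib)) (by linarith))
  have c1 := hA (τ a) (τ i) (τ b) (hτ hai) (hτ (by omega))
  have c2 := (hA (τ i) (τ (i + 1)) (τ b) (hτ (by omega)) (hτ hib)).trans
    (mul_le_mul_of_nonneg_left (Real.rpow_le_rpow (sub_nonneg.2 (hmono i b (by omega)))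
      (show _ ≤ L by linarith [hmono a i hai]) (by linarith)) hC)
  rw [← Finset.sum_Ico_consecutive _ hai (show i ≤ b by omega),
    Finset.sum_eq_sum_Ico_succ_bot (show i < b by omega)]
  rw [abs_le] at *
  constructor <;> nlinarith [b1.1, b1.2, b2.1, b2.2, c1.1, c1.2, c2.1, c2.2, hKeq,
    congrArg (· * L ^ θ) hKeq]

/-- With the points of `F` enumerated in increasing order, the Riemann sum starting at the smallest
point serves as the path. -/
theorem exists_sewing_on_finset {α : Type*} [LinearOrder α] {K : ℝ} {A : α → α → ℝ}
    {ω : α → α → ℝ}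
    (hA : ∀ τ : ℕ → α, Monotone τ → ∀ a b, a ≤ b →
      |∑ i ∈ Finset.Ico a b, A (τ i) (τ (i + 1)) - A (τ a) (τ b)| ≤ K * ω (τ a) (τ b))
    (F : Finset α) :
    ∃ φ : α → ℝ, ∀ s ∈ F, ∀ t ∈ F, s ≤ t → |φ t - φ s - A s t| ≤ K * ω s t := by
  classical
  rcases F.eq_empty_or_nonempty with rfl | hF
  · exact ⟨0, by simp⟩
  have hpos : 0 < F.card := hF.card_pos
  let e := F.orderEmbOfFin rfl
  -- Capping the index makes the enumeration a monotone sequence on all of `ℕ`, constant after the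
  -- last point.
  let τ : ℕ → α := fun i => e ⟨min i (F.card - 1), by omega⟩
  have hτ : Monotone τ := fun i j hij => e.monotone (by
    rw [Fin.mk_le_mk]; exact min_le_min_right _ hij)
  let idx : α → ℕ := fun x => if h : ∃ i : Fin F.card, e i = x then (h.choose : ℕ) else 0
  have hidx : ∀ x ∈ F, τ (idx x) = x := by
    intro x hx
    have hex : ∃ i : Fin F.card, e i = x := by
      have : x ∈ Set.range e := by rw [Finset.range_orderEmbOfFin]; exact hx
      exact this
    have h1 : idx x = hex.choose := dif_pos hex
    have h2 : (⟨min (idx x) (F.card - 1), by omega⟩ : Fin F.card) = hex.choose := by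
      ext
      have := hex.choose.2
      simp only [h1]
      omega
    simp only [τ, h2]
    exact hex.choose_spec
  have hmono : ∀ x ∈ F, ∀ y ∈ F, x ≤ y → idx x ≤ idx y := by
    intro x hx y hy hxy
    by_contra h
    have heq : x = y := le_antisymm hxy
      (by rw [← hidx x hx, ← hidx y hy]; exact hτ (by omega))
    exact h (heq ▸ le_rfl)
  refine ⟨fun x => ∑ i ∈ Finset.range (idx x), A (τ i) (τ (i + 1)), fun s hs t ht hst => ?_⟩
  have h := hA τ hτ _ _ (hmono s hs t ht hst)
  rwa [Finset.sum_Ico_eq_sub _ (hmono s hs t ht hst), hidx s hs, hidx t ht] at h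

/-- An almost additive function is uniformly close to the increments of a path. -/
theorem exists_sewing {T C θ : ℝ} (hθ : 1 < θ) (hC : 0 ≤ C)
    {A : Set.Icc (0 : ℝ) T → Set.Icc (0 : ℝ) T → ℝ}
    (hA : ∀ s u t, s ≤ u → u ≤ t → |A s t - A s u - A u t| ≤ C * ((t : ℝ) - s) ^ θ) :
    ∃ (φ : Set.Icc (0 : ℝ) T → ℝ) (K : ℝ), ∀ s t, s ≤ t →
      |φ t - φ s - A s t| ≤ K * ((t : ℝ) - s) ^ θ := by
  classical
  rcases isEmpty_or_nonempty (Set.Icc (0 : ℝ) T) with hI | ⟨⟨o⟩⟩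
  · exact ⟨0, 0, fun s => isEmptyElim s⟩
  have hT : 0 ≤ T := o.2.1.trans o.2.2
  let z : Set.Icc (0 : ℝ) T := ⟨0, le_rfl, hT⟩
  have hz : ∀ t, z ≤ t := fun t => t.2.1
  set K := 2 * C / (1 - 2 * (1 / 2 : ℝ) ^ θ)
  have key := exists_sewing_on_finset (ω := fun s t : Set.Icc (0 : ℝ) T => ((t : ℝ) - s) ^ θ)
    (fun τ hτ a b hab => abs_sum_sub_le (ρ := fun t : Set.Icc (0 : ℝ) T => (t : ℝ))
      (fun _ _ h => h) hθ hC hA hτ a b hab)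
  choose ψ hψ using key
  -- Normalising at time zero confines `ψ' F t` to a compact interval independent of `F`. An
  -- ultrafilter below `atTop` then yields pointwise limits, with no convergence of Riemann sums to
  -- prove, and the estimate passes to the limit.
  let ψ' : Finset (Set.Icc (0 : ℝ) T) → Set.Icc (0 : ℝ) T → ℝ := fun F t => ψ F t - ψ F z
  let l : Ultrafilter (Finset (Set.Icc (0 : ℝ) T)) := Ultrafilter.of atTop
  have hl : (l : Filter (Finset (Set.Icc (0 : ℝ) T))) ≤ atTop := Ultrafilter.of_le _
  have hmem : ∀ t, ∀ᶠ F in (l : Filter (Finset (Set.Icc (0 : ℝ) T))), t ∈ F := fun t =>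
    hl (by filter_upwards [eventually_ge_atTop {t}] with F hF using hF (by simp))
  have hlim : ∀ t, ∃ y, Tendsto (fun F => ψ' F t) l (𝓝 y) := by
    intro t
    have hcpt : IsCompact (Set.Icc (A z t - K * ((t : ℝ) - z) ^ θ) (A z t + K * ((t : ℝ) - z) ^ θ)) :=
      isCompact_Icc
    obtain ⟨y, -, hy⟩ := hcpt.ultrafilter_le_nhds (l.map fun F => ψ' F t) (by
      rw [Filter.le_principal_iff]
      show ∀ᶠ F in (l : Filter (Finset (Set.Icc (0 : ℝ) T))), _
      filter_upwards [hmem t, hmem z] with F ht hz'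
      have := abs_le.1 (hψ F z hz' t ht (hz t))
      simp only [ψ', Set.mem_Icc]
      constructor <;> linarith [this.1, this.2])
    exact ⟨y, hy⟩
  choose φ hφ using hlim
  refine ⟨φ, K, fun s t hst => ?_⟩
  refine le_of_tendsto ((((hφ t).sub (hφ s)).sub_const (A s t)).abs) ?_
  filter_upwards [hmem t, hmem s] with F ht hs
  have := hψ F s hs t ht hst
  simpa only [ψ', sub_sub_sub_cancel_right] using this

/-! ### Homogeneous bounds for families of series -/

/-- The degree `m` part of the family `g` is of order `h ^ m`, for every `m ≤ n`. -/
def HomogeneousBound {ι : Type*} (l : Filter ι) (h : ι → ℝ) (n : ℕ) (g : ι → TensorSeries d) :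
    Prop :=
  ∀ w : Word d, w.length ≤ n → (fun i => g i w) =O[l] fun i => h i ^ w.length

section

variable {ι : Type*} {l : Filter ι} {h : ι → ℝ}

theorem HomogeneousBound.mono {m n : ℕ} {g : ι → TensorSeries d}
    (hg : HomogeneousBound l h n g) (hm : m ≤ n) : HomogeneousBound l h m g :=
  fun w hw => hg w (hw.trans hm)

theorem HomogeneousBound.congr {n : ℕ} {g g' : ι → TensorSeries d}
    (hg : HomogeneousBound l h n g) (hgg : ∀ i, AgreeTo n (g i) (g' i)) :
    HomogeneousBound l h n g' :=
  fun w hw => (hg w hw).congr_left fun i => hgg i w hw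

theorem homogeneousBound_one (n : ℕ) : HomogeneousBound l h n fun _ => one d := by
  intro w _
  rcases w with _ | ⟨a, w⟩
  · simpa [one_nil] using isBigO_refl (fun _ : ι => (1 : ℝ)) l
  · simpa [one_cons] using isBigO_zero _ l

theorem HomogeneousBound.sub {n : ℕ} {a b : ι → TensorSeries d}
    (ha : HomogeneousBound l h n a) (hb : HomogeneousBound l h n b) :
    HomogeneousBound l h n fun i => a i - b i :=
  fun w hw => (ha w hw).sub (hb w hw)

theorem HomogeneousBound.antipode {n : ℕ} {a : ι → TensorSeries d}
    (ha : HomogeneousBound l h n a) : HomogeneousBound l h n fun i => antipode (a i) := by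
  intro w hw
  have h1 := (ha w.reverse (by simpa using hw)).const_mul_left ((-1) ^ w.length)
  rw [List.length_reverse] at h1
  exact h1

theorem isBigO_mul_take_drop {a b : ι → TensorSeries d} {w : Word d} {i : ℕ}
    (hi : i ≤ w.length)
    (ha : (fun j => a j (w.take i)) =O[l] fun j => h j ^ (w.take i).length)
    (hb : (fun j => b j (w.drop i)) =O[l] fun j => h j ^ (w.drop i).length) :
    (fun j => a j (w.take i) * b j (w.drop i)) =O[l] fun j => h j ^ w.length := by
  refine (ha.mul hb).congr_right fun j => ?_
  rw [← pow_add, List.length_take_of_le hi, List.length_drop, Nat.add_sub_cancel' hi]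

theorem HomogeneousBound.concat {n : ℕ} {a b : ι → TensorSeries d}
    (ha : HomogeneousBound l h n a) (hb : HomogeneousBound l h n b) :
    HomogeneousBound l h n fun i => concat (a i) (b i) := by
  intro w hw
  refine IsBigO.fun_sum fun i hi => ?_
  have hi' : i ≤ w.length := by simpa [Nat.lt_succ_iff] using hi
  exact isBigO_mul_take_drop hi' (ha _ (by simp; omega)) (hb _ (by simp; omega))

/-- Without constant terms only splittings into two nonempty words contribute, and both parts are
then shorter than the word; this gains one degree. -/
theorem HomogeneousBound.concat_succ {n : ℕ} {a b : ι → TensorSeries d}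
    (ha : HomogeneousBound l h n a) (hb : HomogeneousBound l h n b)
    (ha0 : ∀ i, a i [] = 0) (hb0 : ∀ i, b i [] = 0) :
    HomogeneousBound l h (n + 1) fun i => RoughPath.concat (a i) (b i) := by
  intro w hw
  refine IsBigO.fun_sum fun i hi => ?_
  have hi' : i ≤ w.length := by simpa [Nat.lt_succ_iff] using hi
  rcases Nat.eq_zero_or_pos i with rfl | hpos
  · simpa [ha0] using isBigO_zero _ l
  rcases hi'.eq_or_lt with rfl | hlt
  · simpa [hb0] using isBigO_zero _ l
  exact isBigO_mul_take_drop hi' (ha _ (by simp; omega)) (hb _ (by simp; omega))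

/-! ### Powers, logarithms and the homogeneous norm -/

theorem powTrunc_succ_nil {n : ℕ} {u : TensorSeries d} (hu : u [] = 0) (k : ℕ) :
    powTrunc n u (k + 1) [] = 0 := by
  simp [powTrunc, concatTrunc, trunc, concat_nil, hu]

theorem HomogeneousBound.powTrunc {m n : ℕ} (hm : m ≤ n) {u : ι → TensorSeries d}
    (hu : HomogeneousBound l h m u) (k : ℕ) :
    HomogeneousBound l h m fun i => powTrunc n (u i) k := by
  induction k with
  | zero => exact homogeneousBound_one m
  | succ k ih =>
    exact (hu.concat ih).congr fun i => ((agreeTo_trunc n _).mono hm).symm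

theorem HomogeneousBound.powTrunc_succ {m n : ℕ} (hm : m + 1 ≤ n) {u : ι → TensorSeries d}
    (hu : HomogeneousBound l h m u) (hu0 : ∀ i, u i [] = 0) (k : ℕ) :
    HomogeneousBound l h (m + 1) fun i => RoughPath.powTrunc n (u i) (k + 2) :=
  (hu.concat_succ (hu.powTrunc (by omega) (k + 1)) hu0 fun i => powTrunc_succ_nil (hu0 i) k).congr
    fun _ => ((agreeTo_trunc n _).mono hm).symm

theorem powTrunc_one_apply {n : ℕ} {u : TensorSeries d} : AgreeTo n (powTrunc n u 1) u :=
  fun w hw => (agreeTo_trunc n (concat u (one d)) w hw).trans (by rw [concat_one])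

/-- The logarithm of `1 + u` is `u` plus powers of order at least two, whose degree `m + 1` part
involves `u` only up to degree `m`. Induction on the degree thus inverts the logarithm without using
the exponential. -/
theorem homogeneousBound_logTrunc_iff {n : ℕ} {g : ι → TensorSeries d} (hg : ∀ i, g i [] = 1) :
    HomogeneousBound l h n (fun i => logTrunc n (g i)) ↔ HomogeneousBound l h n g := by
  constructor
  · intro hlog
    have hu0 : ∀ i, (g i - one d) [] = 0 := fun i => by simp [hg, one_nil]
    have key : ∀ m, m ≤ n → HomogeneousBound l h m fun i => g i - one d := by
      intro m
      induction m with
      | zero =>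
        intro _ w hw
        obtain rfl : w = [] := List.eq_nil_of_length_eq_zero (by omega)
        simpa only [hu0] using isBigO_zero _ l
      | succ m ih =>
        intro hm w hw
        have hsum : ∀ i, (g i - one d) w = logTrunc n (g i) w -
            ∑ k ∈ Finset.Ioc 1 n,
              (-1 : ℝ) ^ (k - 1) / k * powTrunc n (g i - one d) k w := by
          intro i
          rw [logTrunc, Finset.sum_apply, ← Finset.add_sum_Ioc_eq_sum_Icc (by omega)]
          simp [powTrunc_one_apply (n := n) w (hw.trans hm)]
        simp only [hsum]
        refine (hlog w (hw.trans hm)).sub (IsBigO.fun_sum fun k hk => ?_)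
        obtain ⟨k, rfl⟩ : ∃ j, k = j + 2 := ⟨k - 2, by have := (Finset.mem_Ioc.1 hk).1; omega⟩
        exact ((ih (by omega)).powTrunc_succ hm hu0 k w hw).const_mul_left _
    intro w hw
    simpa using (key n le_rfl w hw).add (homogeneousBound_one n w hw)
  · intro hg' w hw
    simp only [logTrunc, Finset.sum_apply]
    exact IsBigO.fun_sum fun k _ =>
      (((hg'.sub (homogeneousBound_one n)).powTrunc le_rfl k) w hw).const_mul_left _

theorem levelNorm_nonneg (m : ℕ) (g : TensorSeries d) : 0 ≤ levelNorm m g := Real.sqrt_nonneg _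

/-- There are finitely many words of length `m`, so the Euclidean norm is comparable with its
coordinates; the root turns order `h ^ m` into order `h`. -/
theorem isBigO_levelNorm_rpow_iff (hh : ∀ i, 0 ≤ h i) {m : ℕ} (hm : m ≠ 0)
    {g : ι → TensorSeries d} :
    (fun i => levelNorm m (g i) ^ (1 / (m : ℝ))) =O[l] h ↔
      ∀ w : Fin m → Fin d, (fun i => g i (List.ofFn w)) =O[l] fun i => h i ^ m := by
  constructor
  · intro H w
    have h1 : (fun i => g i (List.ofFn w)) =O[l] fun i => levelNorm m (g i) := by
      refine isBigO_of_le _ fun i => ?_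
      rw [Real.norm_of_nonneg (levelNorm_nonneg _ _), Real.norm_eq_abs]
      exact Real.abs_le_sqrt (Finset.single_le_sum
        (f := fun w : Fin m → Fin d => g i (List.ofFn w) ^ 2) (fun _ _ => sq_nonneg _)
        (Finset.mem_univ w))
    refine h1.trans ((H.pow m).congr_left fun i => ?_)
    rw [one_div, Real.rpow_inv_natCast_pow (levelNorm_nonneg _ _) hm]
  · intro H
    have h1 : (fun i => ∑ w : Fin m → Fin d, g i (List.ofFn w) ^ 2) =O[l]
        fun i => (h i ^ m) ^ 2 :=
      IsBigO.fun_sum fun w _ => (H w).pow 2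
    have h2 : (fun i => levelNorm m (g i)) =O[l] fun i => h i ^ m := by
      refine ((h1.rpow (r := 1 / 2) (by norm_num)
        (Eventually.of_forall fun i => by positivity))).congr (fun i => ?_) fun i => ?_
      · simp [levelNorm, Real.sqrt_eq_rpow]
      · rw [← Real.sqrt_eq_rpow, Real.sqrt_sq (pow_nonneg (hh i) m)]
    refine (h2.rpow (r := 1 / (m : ℝ)) (by positivity)
      (Eventually.of_forall fun i => pow_nonneg (hh i) m)).congr_right fun i => ?_
    rw [one_div, Real.pow_rpow_inv_natCast (hh i) hm]

theorem isBigO_grpNorm_iff (hh : ∀ i, 0 ≤ h i) {n : ℕ} {g : ι → TensorSeries d}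
    (hg : ∀ i, g i [] = 1) :
    (fun i => grpNorm n (g i)) =O[l] h ↔ HomogeneousBound l h n g := by
  rw [← homogeneousBound_logTrunc_iff hg]
  have hnonneg : ∀ i, ∀ m ∈ Finset.Icc 1 n,
      0 ≤ levelNorm m (logTrunc n (g i)) ^ (1 / (m : ℝ)) :=
    fun i m _ => Real.rpow_nonneg (levelNorm_nonneg _ _) _
  constructor
  · intro H w hw
    rcases Nat.eq_zero_or_pos w.length with h0 | hpos
    · obtain rfl := List.eq_nil_of_length_eq_zero h0
      have : ∀ i, logTrunc n (g i) [] = 0 := by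
        intro i
        rw [logTrunc, Finset.sum_apply]
        refine Finset.sum_eq_zero fun k hk => ?_
        obtain ⟨k, rfl⟩ : ∃ j, k = j + 1 := ⟨k - 1, by have := (Finset.mem_Icc.1 hk).1; omega⟩
        simp [powTrunc_succ_nil (u := g i - one d) (by simp [hg, one_nil])]
      exact (isBigO_zero (E' := ℝ) _ l).congr_left fun i => (this i).symm
    · have h1 : (fun i => levelNorm w.length (logTrunc n (g i)) ^ (1 / (w.length : ℝ))) =O[l]
          fun i => grpNorm n (g i) := by
        refine isBigO_of_le _ fun i => ?_
        have hmem : w.length ∈ Finset.Icc 1 n := Finset.mem_Icc.2 ⟨hpos, hw⟩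
        rw [Real.norm_of_nonneg (hnonneg i _ hmem), grpNorm,
          Real.norm_of_nonneg (Finset.sum_nonneg (hnonneg i))]
        exact Finset.single_le_sum (hnonneg i) hmem
      have := (isBigO_levelNorm_rpow_iff hh hpos.ne').1 (h1.trans H) w.get
      simpa using this
  · intro H
    refine IsBigO.fun_sum fun m hm => ?_
    rw [Finset.mem_Icc] at hm
    refine (isBigO_levelNorm_rpow_iff hh (by omega)).2 fun w => ?_
    simpa using H (List.ofFn w) (by simpa using hm.2)

end

/-! ### The top degree of a product -/

theorem trunc_one (n : ℕ) : trunc n (one d) = one d := by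
  funext w
  cases w <;> simp [trunc, one]

theorem concat_eq_add_left {n : ℕ} (a b : TensorSeries d) {w : Word d} (hw : w.length = n + 1) :
    concat a b w = concat (trunc n a) b w + a w * b [] := by
  have h : ∀ i ∈ Finset.range w.length, a (w.take i) * b (w.drop i) =
      trunc n a (w.take i) * b (w.drop i) := by
    intro i hi
    rw [Finset.mem_range] at hi
    rw [agreeTo_trunc n a _ (by simp; omega)]
  simp only [concat, Finset.sum_range_succ _ w.length, Finset.sum_congr rfl h]
  rw [List.take_length, List.drop_length]
  simp [trunc, hw]

theorem concat_eq_add_right {n : ℕ} (a b : TensorSeries d) {w : Word d} (hw : w.length = n + 1) :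
    concat a b w = concat a (trunc n b) w + a [] * b w := by
  have h : ∀ i ∈ Finset.range w.length, a (w.take (i + 1)) * b (w.drop (i + 1)) =
      a (w.take (i + 1)) * trunc n b (w.drop (i + 1)) := by
    intro i hi
    rw [Finset.mem_range] at hi
    rw [agreeTo_trunc n b _ (by simp; omega)]
  simp only [concat, Finset.sum_range_succ' _ w.length, Finset.sum_congr rfl h]
  simp [trunc, hw]

/-- Only the two trivial splittings see the top degree, which therefore enters additively. This is
what makes differences of solutions of Chen's relation additive in time. -/
theorem concat_eq_add {n : ℕ} {a b : TensorSeries d} (ha : a [] = 1) (hb : b [] = 1) {w : Word d}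
    (hw : w.length = n + 1) :
    concat a b w = concat (trunc n a) (trunc n b) w + a w + b w := by
  rw [concat_eq_add_left a b hw, concat_eq_add_right (trunc n a) b hw, hb]
  simp [trunc, ha]
  ring

/-- The analogue for pairs of words: `F'` differs from `F` only when the first factor takes
everything, and `G'` from `G` only when the second does. -/
theorem concat₂_eq_add {n : ℕ} {F F' G G' : TensorSeries₂ d}
    (hF : ∀ u v : Word d, u.length + v.length ≤ n → F' u v = F u v)
    (hG : ∀ u v : Word d, u.length + v.length ≤ n → G' u v = G u v)
    {u v : Word d} (huv : u.length + v.length = n + 1) :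
    concat₂ F' G' u v = concat₂ F G u v + (F' u v - F u v) * G' [] [] +
      F [] [] * (G' u v - G u v) := by
  have h1 : ∑ i ∈ Finset.range (u.length + 1), ∑ j ∈ Finset.range (v.length + 1),
      (F' (u.take i) (v.take j) - F (u.take i) (v.take j)) * G' (u.drop i) (v.drop j) =
        (F' u v - F u v) * G' [] [] := by
    rw [Finset.sum_eq_single u.length, Finset.sum_eq_single v.length]
    · simp
    · intro j hj hne
      rw [Finset.mem_range] at hj
      rw [hF _ _ (by simp only [List.length_take]; omega), sub_self, zero_mul]
    · simp
    · intro i hi hne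
      rw [Finset.mem_range] at hi
      refine Finset.sum_eq_zero fun j hj => ?_
      rw [hF _ _ (by simp only [List.length_take]; omega), sub_self, zero_mul]
    · simp
  have h2 : ∑ i ∈ Finset.range (u.length + 1), ∑ j ∈ Finset.range (v.length + 1),
      F (u.take i) (v.take j) * (G' (u.drop i) (v.drop j) - G (u.drop i) (v.drop j)) =
        F [] [] * (G' u v - G u v) := by
    rw [Finset.sum_eq_single 0, Finset.sum_eq_single 0]
    · simp
    · intro j hj hne
      rw [Finset.mem_range] at hj
      rw [hG _ _ (by simp only [List.length_drop]; omega), sub_self, mul_zero]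
    · simp
    · intro i hi hne
      rw [Finset.mem_range] at hi
      refine Finset.sum_eq_zero fun j hj => ?_
      rw [hG _ _ (by simp only [List.length_drop]; omega), sub_self, mul_zero]
    · simp
  rw [← h1, ← h2, concat₂, concat₂, ← Finset.sum_add_distrib, ← Finset.sum_add_distrib]
  refine Finset.sum_congr rfl fun i _ => ?_
  rw [← Finset.sum_add_distrib, ← Finset.sum_add_distrib]
  exact Finset.sum_congr rfl fun j _ => by ring

theorem HomogeneousBound.shufflePair {ι : Type*} {l : Filter ι} {h : ι → ℝ} {n : ℕ}
    {g : ι → TensorSeries d} (hg : HomogeneousBound l h n g) {u v : Word d}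
    (huv : u.length + v.length ≤ n) :
    (fun i => shufflePair (g i) u v) =O[l] fun i => h i ^ (u.length + v.length) := by
  simp only [← coprod_eq_shufflePair, coprod, mul_comm (g _ _)]
  refine IsBigO.fun_sum fun w _ => IsBigO.const_mul_left ?_ _
  simpa only [List.length_ofFn] using hg (List.ofFn w) (by simpa using huv)

/-! ### Two-parameter rough paths of finite level -/

/-- Multiplicative two-parameter families of characters of level `n`, with homogeneous
`γ`-Hölder bounds. -/
structure IsRough {T : ℝ} (γ : ℝ) (n : ℕ)
    (x : Set.Icc (0 : ℝ) T → Set.Icc (0 : ℝ) T → TensorSeries d) : Prop where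
  char : ∀ s t, IsChar n (x s t)
  refl : ∀ t, AgreeTo n (x t t) (one d)
  chen : ∀ s u t, AgreeTo n (x s t) (concat (x s u) (x u t))
  bound : HomogeneousBound (𝓟 {p : Set.Icc (0 : ℝ) T × Set.Icc (0 : ℝ) T | p.1 ≤ p.2})
    (fun p => |(p.2 : ℝ) - p.1| ^ γ) n (fun p => x p.1 p.2)

section

variable {T γ : ℝ} {n : ℕ} {x y : Set.Icc (0 : ℝ) T → Set.Icc (0 : ℝ) T → TensorSeries d}

theorem IsRough.congr (hx : IsRough γ n x) (h : ∀ s t, AgreeTo n (x s t) (y s t)) :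
    IsRough γ n y where
  char s t := (hx.char s t).congr (h s t)
  refl t := (h t t).symm.trans (hx.refl t)
  chen s u t := (h s t).symm.trans ((hx.chen s u t).trans ((h s u).concat (h u t)))
  bound := hx.bound.congr fun p => h p.1 p.2

theorem IsRough.mono {m : ℕ} (hx : IsRough γ n x) (hm : m ≤ n) : IsRough γ m x where
  char s t := (hx.char s t).mono hm
  refl t := (hx.refl t).mono hm
  chen s u t := (hx.chen s u t).mono hm
  bound := hx.bound.mono hm

/-- Chen's relation makes `x t s` a right inverse of `x s t`, while the antipode is a left inverse;
associativity identifies them. -/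
theorem IsRough.antipode (hx : IsRough γ n x) (s t : Set.Icc (0 : ℝ) T) :
    AgreeTo n (antipode (x s t)) (x t s) := by
  have h1 := (AgreeTo.refl n (RoughPath.antipode (x s t))).concat
    ((hx.refl s).symm.trans (hx.chen s t s))
  have h2 := (hx.char s t).antipode_concat.concat (AgreeTo.refl n (x t s))
  rw [concat_assoc, one_concat] at h2
  rw [concat_one] at h1
  exact h1.trans h2

/-- Reversing time is the antipode, which preserves homogeneous bounds. This reconciles estimates
over `s < t` with estimates over `s ≠ t`. -/
theorem IsRough.bound_top (hx : IsRough γ n x) :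
    HomogeneousBound (⊤ : Filter (Set.Icc (0 : ℝ) T × Set.Icc (0 : ℝ) T))
      (fun p => |(p.2 : ℝ) - p.1| ^ γ) n (fun p => x p.1 p.2) := by
  intro w hw
  have h1 := hx.bound w hw
  have h2 : (fun p : Set.Icc (0 : ℝ) T × Set.Icc (0 : ℝ) T => x p.1 p.2 w)
      =O[𝓟 {p : Set.Icc (0 : ℝ) T × Set.Icc (0 : ℝ) T | p.2 ≤ p.1}]
      fun p => (|(p.2 : ℝ) - p.1| ^ γ) ^ w.length := by
    have h3 := (hx.bound.antipode w hw).comp_tendsto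
      (show Tendsto Prod.swap (𝓟 {p : Set.Icc (0 : ℝ) T × Set.Icc (0 : ℝ) T | p.2 ≤ p.1})
        (𝓟 {p | p.1 ≤ p.2}) from tendsto_principal_principal.2 fun p hp => hp)
    refine h3.congr (fun p => ?_) fun p => ?_
    · exact hx.antipode p.2 p.1 w hw
    · simp [abs_sub_comm]
  refine (h1.sup h2).mono ?_
  rw [sup_principal, ← principal_univ, principal_mono]
  exact fun p _ => le_total p.1 p.2

theorem HomogeneousBound.le_of_lt (hx : ∀ t, AgreeTo n (x t t) (one d))
    (hb : HomogeneousBound (𝓟 {p : Set.Icc (0 : ℝ) T × Set.Icc (0 : ℝ) T | p.1 < p.2})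
      (fun p => |(p.2 : ℝ) - p.1| ^ γ) n (fun p => x p.1 p.2)) :
    HomogeneousBound (𝓟 {p : Set.Icc (0 : ℝ) T × Set.Icc (0 : ℝ) T | p.1 ≤ p.2})
      (fun p => |(p.2 : ℝ) - p.1| ^ γ) n (fun p => x p.1 p.2) := by
  intro w hw
  have h2 : (fun p : Set.Icc (0 : ℝ) T × Set.Icc (0 : ℝ) T => x p.1 p.2 w)
      =O[𝓟 {p : Set.Icc (0 : ℝ) T × Set.Icc (0 : ℝ) T | p.1 = p.2}]
      fun p => (|(p.2 : ℝ) - p.1| ^ γ) ^ w.length := by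
    refine (homogeneousBound_one n w hw).congr' ?_ EventuallyEq.rfl
    refine eventually_principal.2 fun p hp => ?_
    obtain ⟨s, t⟩ := p
    obtain rfl : s = t := hp
    exact (hx s w hw).symm
  refine ((hb w hw).sup h2).mono ?_
  rw [sup_principal, principal_mono]
  exact fun p (hp : p.1 ≤ p.2) => lt_or_eq_of_le hp

/-- The increments of a path of characters form a multiplicative family. -/
theorem isRough_incr {X : Set.Icc (0 : ℝ) T → TensorSeries d} (hX : ∀ t, IsChar n (X t))
    (hb : HomogeneousBound (𝓟 {p : Set.Icc (0 : ℝ) T × Set.Icc (0 : ℝ) T | p.1 < p.2})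
      (fun p => |(p.2 : ℝ) - p.1| ^ γ) n (fun p => incr X p.1 p.2)) :
    IsRough γ n (incr X) where
  char s t := (hX s).antipode.concat (hX t)
  refl t := (hX t).antipode_concat
  chen s u t := by
    have h := ((hX u).concat_antipode.concat (AgreeTo.refl n (X t))).symm
    rw [one_concat] at h
    have h' := (AgreeTo.refl n (RoughPath.antipode (X s))).concat h
    simpa only [incr, concat_assoc] using h'
  bound := HomogeneousBound.le_of_lt (fun t => (hX t).antipode_concat) hb

theorem IsRough.agreeTo_incr (hx : IsRough γ n x) (o s t : Set.Icc (0 : ℝ) T) :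
    AgreeTo n (incr (x o) s t) (x s t) :=
  ((hx.antipode o s).concat (AgreeTo.refl n _)).trans (hx.chen s o t).symm

theorem abs_rpow_pow (r : ℝ) (k : ℕ) : (|r| ^ γ) ^ k = |r| ^ (γ * k) :=
  (Real.rpow_mul_natCast (abs_nonneg r) γ k).symm

/-- Additive functions that are Hölder continuous of order greater than one vanish. -/
theorem additive_eq_zero_of_isBigO {k : ℕ} (hk : 1 < γ * k)
    {E : Set.Icc (0 : ℝ) T → Set.Icc (0 : ℝ) T → ℝ} (hadd : ∀ s u t, E s t = E s u + E u t)
    (hE : (fun p : Set.Icc (0 : ℝ) T × Set.Icc (0 : ℝ) T => E p.1 p.2)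
      =O[𝓟 {p : Set.Icc (0 : ℝ) T × Set.Icc (0 : ℝ) T | p.1 ≤ p.2}]
        fun p => (|(p.2 : ℝ) - p.1| ^ γ) ^ k) (s t : Set.Icc (0 : ℝ) T) : E s t = 0 := by
  obtain ⟨C, hC⟩ := isBigO_principal.1 hE
  refine additive_eq_zero (C := C) hk hadd (fun s t hst => ?_) s t
  have := hC (s, t) hst
  rwa [abs_rpow_pow, Real.norm_eq_abs, Real.norm_of_nonneg (by positivity)] at this

/-- Degree by degree above `N`, the difference of the two families is additive in time by
`concat_eq_add` and Hölder of order greater than one, hence zero. -/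
theorem IsRough.agreeTo_of_agreeTo {N : ℕ} (hN : 1 < γ * (N + 1 : ℕ)) (hγ : 0 < γ)
    (hx : IsRough γ n x) (hy : IsRough γ n y) (h : ∀ s t, AgreeTo N (x s t) (y s t))
    (s t : Set.Icc (0 : ℝ) T) : AgreeTo n (x s t) (y s t) := by
  have key : ∀ k, ∀ s t, ∀ w : Word d, w.length ≤ N + k → w.length ≤ n → x s t w = y s t w := by
    intro k
    induction k with
    | zero => exact fun s t w hw _ => h s t w hw
    | succ k ih =>
      intro s t w hw hwn
      rcases hw.lt_or_eq with hlt | heq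
      · exact ih s t w (by omega) hwn
      have hw' : w.length = (N + k) + 1 := heq
      rw [← sub_eq_zero]
      refine additive_eq_zero_of_isBigO (γ := γ) (k := w.length)
        (E := fun s t => x s t w - y s t w) (hN.trans_le ?_) (fun s u t => ?_)
        ((hx.bound w hwn).sub (hy.bound w hwn)) s t
      · exact mul_le_mul_of_nonneg_left (by exact_mod_cast (by omega)) hγ.le
      · have e : ∀ s t, trunc (N + k) (x s t) = trunc (N + k) (y s t) := fun s t =>
          trunc_eq_trunc_iff.2 fun v hv => ih s t v hv (by omega)
        simp only [hx.chen s u t w hwn, hy.chen s u t w hwn,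
          concat_eq_add (hx.char s u).1 (hx.char u t).1 hw',
          concat_eq_add (hy.char s u).1 (hy.char u t).1 hw', e]
        ring
  exact fun w hw => key n s t w (by omega) hw

/-! ### Extension to higher levels -/

/-- Multiplicativity in the new degree comes for free. Both the shuffle pairing and the product of
values are compatible with concatenation and they agree in lower degrees, so their difference is
additive in time, and its Hölder order exceeds one. -/
theorem IsRough.succ (hn : 1 < γ * (n + 1 : ℕ)) (hx : IsRough γ n x)
    (hchen : ∀ s u t, AgreeTo (n + 1) (x s t) (concat (x s u) (x u t)))
    (hbound : HomogeneousBound (𝓟 {p : Set.Icc (0 : ℝ) T × Set.Icc (0 : ℝ) T | p.1 ≤ p.2})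
      (fun p => |(p.2 : ℝ) - p.1| ^ γ) (n + 1) (fun p => x p.1 p.2)) : IsRough γ (n + 1) x where
  char s t := by
    refine ⟨(hx.char s t).1, fun u v huv => ?_⟩
    rcases huv.lt_or_eq with hlt | heq
    · exact (hx.char s t).2 u v (by omega)
    rw [← sub_eq_zero]
    refine additive_eq_zero_of_isBigO (γ := γ) (k := n + 1)
      (E := fun s t => shufflePair (x s t) u v - x s t u * x s t v) hn (fun s r t => ?_) ?_ s t
    · have h1 : shufflePair (x s t) u v = shufflePair (concat (x s r) (x r t)) u v :=
        shufflePair_congr fun w hw => hchen s r t w (by omega)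
      have h2 := congrFun (congrFun (concat₂_tmul (x s r) (x s r) (x r t) (x r t)) u) v
      have h3 := concat₂_eq_add (F := tmul (x s r) (x s r)) (G := tmul (x r t) (x r t))
        (hx.char s r).2 (hx.char r t).2 heq
      have h4 : tmul (concat (x s r) (x r t)) (concat (x s r) (x r t)) u v = x s t u * x s t v := by
        rw [hchen s r t u (by omega), hchen s r t v (by omega)]; rfl
      rw [h1, shufflePair_concat, h3, h2, h4]
      simp only [shufflePair_nil_left, tmul, (hx.char s r).1, (hx.char r t).1]
      ring
    · have h1 := hbound.shufflePair huv
      have h2 := (hbound u (by omega)).mul (hbound v (by omega))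
      simp only [← pow_add] at h2
      rw [heq] at h1 h2
      exact h1.sub h2
  refl t := by
    intro w hw
    rcases hw.lt_or_eq with hlt | heq
    · exact hx.refl t w (by omega)
    -- In the top degree this reads `x t t w = x t t w + x t t w`.
    have h := hchen t t t w hw
    rw [concat_eq_add (hx.char t t).1 (hx.char t t).1 heq,
      trunc_eq_trunc_iff.2 (hx.refl t), trunc_one, one_concat] at h
    have h1 : one d w = 0 := if_neg fun h0 => by simp [h0] at heq
    linarith
  chen := hchen
  bound := hbound

/-- The product `R s u t` of truncated increments is the forced part of Chen's relation in degree `n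
+ 1`. Since it is a cocycle, `-R o s t` solves the relation algebraically but may violate the bound;
adding the increments of a path keeps the relation, and sewing finds a path that restores the bound.
-/
theorem IsRough.exists_extension (hT : 0 ≤ T) (hγ : 0 < γ) (hn : 1 < γ * (n + 1 : ℕ))
    (hx : IsRough γ n x) :
    ∃ y : Set.Icc (0 : ℝ) T → Set.Icc (0 : ℝ) T → TensorSeries d,
      IsRough γ (n + 1) y ∧ ∀ s t, AgreeTo n (y s t) (x s t) := by
  let o : Set.Icc (0 : ℝ) T := ⟨0, le_rfl, hT⟩
  let z : Set.Icc (0 : ℝ) T → Set.Icc (0 : ℝ) T → TensorSeries d := fun s t => trunc n (x s t)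
  let R := fun s u t => concat (z s u) (z u t)
  have hz0 : ∀ s t, z s t [] = 1 := fun s t => by simp [z, trunc, (hx.char s t).1]
  have hzz : ∀ s u t, trunc n (R s u t) = z s t := fun s u t =>
    trunc_eq_trunc_iff.2 ((AgreeTo.concat (agreeTo_trunc n _) (agreeTo_trunc n _)).trans
      (hx.chen s u t).symm)
  -- Associativity of the triple product, with the top degree of each inner product split off.
  have hcocycle : ∀ r s u t, ∀ w : Word d, w.length = n + 1 →
      R r s u w + R r u t w = R s u t w + R r s t w := by
    intro r s u t w hw
    have h := congrFun (concat_assoc (z r s) (z s u) (z u t)) w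
    have h1 := concat_eq_add_left (R r s u) (z u t) hw
    have h2 := concat_eq_add_right (z r s) (R s u t) hw
    rw [hzz, hz0] at h1 h2
    simp only [R] at h h1 h2 ⊢
    linarith
  have hzb : HomogeneousBound (𝓟 {p : Set.Icc (0 : ℝ) T × Set.Icc (0 : ℝ) T | p.1 ≤ p.2})
      (fun p => |(p.2 : ℝ) - p.1| ^ γ) (n + 1) (fun p => z p.1 p.2) := by
    intro w hw
    by_cases h : w.length ≤ n
    · simpa [z, trunc, h] using hx.bound w h
    · simpa [z, trunc, h] using isBigO_zero _ _
  have hR : ∀ w : Word d, w.length = n + 1 → ∃ C : ℝ, 0 ≤ C ∧ ∀ s u t, s ≤ u → u ≤ t →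
      |R s u t w| ≤ C * ((t : ℝ) - s) ^ (γ * (n + 1 : ℕ)) := by
    intro w hw
    let S : Set (Set.Icc (0 : ℝ) T × Set.Icc (0 : ℝ) T × Set.Icc (0 : ℝ) T) :=
      {q | q.1 ≤ q.2.1 ∧ q.2.1 ≤ q.2.2}
    have key : HomogeneousBound (𝓟 S) (fun q => |(q.2.2 : ℝ) - q.1| ^ γ) (n + 1)
        (fun q => R q.1 q.2.1 q.2.2) := by
      apply HomogeneousBound.concat
      · intro v hv
        refine ((hzb v hv).comp_tendsto (k := fun q : Set.Icc (0 : ℝ) T × Set.Icc (0 : ℝ) T ×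
          Set.Icc (0 : ℝ) T => (q.1, q.2.1)) (tendsto_principal_principal.2
            fun q (hq : q ∈ S) => hq.1)).trans (IsBigO.of_bound 1 (eventually_principal.2 ?_))
        rintro ⟨s, u, t⟩ ⟨hsu, hut⟩
        have h1 : (s : ℝ) ≤ u := hsu
        have h2 : (u : ℝ) ≤ t := hut
        simp only [Function.comp_apply, one_mul]
        rw [Real.norm_of_nonneg (by positivity), Real.norm_of_nonneg (by positivity)]
        gcongr ?_ ^ v.length
        refine Real.rpow_le_rpow (abs_nonneg _) ?_ hγ.le
        rw [abs_of_nonneg (by linarith), abs_of_nonneg (by linarith)]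
        linarith
      · intro v hv
        refine ((hzb v hv).comp_tendsto (k := fun q : Set.Icc (0 : ℝ) T × Set.Icc (0 : ℝ) T ×
          Set.Icc (0 : ℝ) T => (q.2.1, q.2.2)) (tendsto_principal_principal.2
            fun q (hq : q ∈ S) => hq.2)).trans (IsBigO.of_bound 1 (eventually_principal.2 ?_))
        rintro ⟨s, u, t⟩ ⟨hsu, hut⟩
        have h1 : (s : ℝ) ≤ u := hsu
        have h2 : (u : ℝ) ≤ t := hut
        simp only [Function.comp_apply, one_mul]
        rw [Real.norm_of_nonneg (by positivity), Real.norm_of_nonneg (by positivity)]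
        gcongr ?_ ^ v.length
        refine Real.rpow_le_rpow (abs_nonneg _) ?_ hγ.le
        rw [abs_of_nonneg (by linarith), abs_of_nonneg (by linarith)]
        linarith
    obtain ⟨C, hC⟩ := isBigO_principal.1 (key w hw.le)
    refine ⟨max C 0, le_max_right _ _, fun s u t hsu hut => ?_⟩
    have hst : (s : ℝ) ≤ t := hsu.trans hut
    have := hC (s, u, t) ⟨hsu, hut⟩
    rw [hw, abs_rpow_pow, Real.norm_eq_abs, Real.norm_of_nonneg (by positivity),
      abs_of_nonneg (sub_nonneg.2 hst)] at this
    exact this.trans (mul_le_mul_of_nonneg_right (le_max_left _ _)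
      (Real.rpow_nonneg (sub_nonneg.2 hst) _))
  have hsew : ∀ w : Word d, ∃ φ : Set.Icc (0 : ℝ) T → ℝ, w.length = n + 1 → ∃ K : ℝ, ∀ s t, s ≤ t →
      |φ t - φ s - R o s t w| ≤ K * ((t : ℝ) - s) ^ (γ * (n + 1 : ℕ)) := by
    intro w
    by_cases hw : w.length = n + 1
    · obtain ⟨C, hC0, hC⟩ := hR w hw
      obtain ⟨φ, K, h⟩ := exists_sewing hn hC0 (A := fun s t => R o s t w) fun s u t hsu hut => by
        have h := hcocycle o s u t w hw
        rw [show R o s t w - R o s u w - R o u t w = -R s u t w by linarith, abs_neg]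
        exact hC s u t hsu hut
      exact ⟨φ, fun _ => ⟨K, h⟩⟩
    · exact ⟨0, fun h => absurd h hw⟩
  choose φ hφ using hsew
  -- The second branch matters only in degree `n + 1`; coefficients of longer words are irrelevant
  -- at this level.
  let y : Set.Icc (0 : ℝ) T → Set.Icc (0 : ℝ) T → TensorSeries d := fun s t w =>
    if w.length ≤ n then x s t w else φ w t - φ w s - R o s t w
  have hyx : ∀ s t, AgreeTo n (y s t) (x s t) := fun s t w hw => if_pos hw
  have hytop : ∀ s t, ∀ w : Word d, w.length = n + 1 → y s t w = φ w t - φ w s - R o s t w :=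
    fun s t w hw => if_neg (by omega)
  have hyz : ∀ s t, trunc n (y s t) = z s t := fun s t => trunc_eq_trunc_iff.2 (hyx s t)
  have hy : IsRough γ n y := hx.congr fun s t => (hyx s t).symm
  refine ⟨y, hy.succ hn ?_ ?_, hyx⟩
  · intro s u t w hw
    rcases hw.lt_or_eq with hlt | heq
    · exact hy.chen s u t w (by omega)
    have h := hcocycle o s u t w heq
    rw [concat_eq_add (hy.char s u).1 (hy.char u t).1 heq, hyz, hyz, hytop _ _ _ heq,
      hytop _ _ _ heq, hytop _ _ _ heq]
    simp only [R] at h ⊢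
    linarith
  · intro w hw
    rcases hw.lt_or_eq with hlt | heq
    · exact hy.bound w (by omega)
    obtain ⟨K, hK⟩ := hφ w heq
    refine isBigO_principal.2 ⟨K, fun p hp => ?_⟩
    have hst : (p.1 : ℝ) ≤ p.2 := hp
    have hp1 := hytop p.1 p.2 w heq
    simp only [hp1]
    rw [heq, abs_rpow_pow, Real.norm_eq_abs, Real.norm_of_nonneg (by positivity),
      abs_of_nonneg (sub_nonneg.2 hst)]
    exact hK p.1 p.2 hp

/-- Extension of a rough path of level `N > 1 / γ - 1` to all levels. -/
theorem IsRough.exists_extension_top {N : ℕ} (hT : 0 ≤ T) (hγ : 0 < γ)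
    (hN : 1 < γ * (N + 1 : ℕ)) (hx : IsRough γ N x) :
    ∃ y : Set.Icc (0 : ℝ) T → Set.Icc (0 : ℝ) T → TensorSeries d,
      (∀ n, IsRough γ n y) ∧ ∀ s t, AgreeTo N (y s t) (x s t) := by
  have hstep : ∀ k, ∀ x : Set.Icc (0 : ℝ) T → Set.Icc (0 : ℝ) T → TensorSeries d,
      IsRough γ (N + k) x → ∃ y : Set.Icc (0 : ℝ) T → Set.Icc (0 : ℝ) T → TensorSeries d,
        IsRough γ (N + k + 1) y ∧ ∀ s t, AgreeTo (N + k) (y s t) (x s t) :=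
    fun k x hx => hx.exists_extension hT hγ (hN.trans_le
      (mul_le_mul_of_nonneg_left (by exact_mod_cast (by omega)) hγ.le))
  choose F hF hFx using hstep
  let Y : ∀ k, {y : Set.Icc (0 : ℝ) T → Set.Icc (0 : ℝ) T → TensorSeries d //
      IsRough γ (N + k) y} :=
    fun k => Nat.rec ⟨x, hx⟩ (fun k p => ⟨F k p.1 p.2, hF k p.1 p.2⟩) k
  have hY : ∀ k s t, AgreeTo (N + k) ((Y (k + 1)).1 s t) ((Y k).1 s t) :=
    fun k => hFx k (Y k).1 (Y k).2
  have hYY : ∀ j k s t, AgreeTo (N + k) ((Y (k + j)).1 s t) ((Y k).1 s t) := by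
    intro j
    induction j with
    | zero => exact fun k s t w _ => rfl
    | succ j ih =>
      exact fun k s t => ((hY (k + j) s t).mono (by omega)).trans (ih k s t)
  -- A diagonal choice: `Y k` has level `N + k` and later extensions leave these degrees unchanged,
  -- so `Y w.length` already has the final coefficient of `w`.
  let y : Set.Icc (0 : ℝ) T → Set.Icc (0 : ℝ) T → TensorSeries d :=
    fun s t w => (Y w.length).1 s t w
  have hy : ∀ k s t, AgreeTo k ((Y k).1 s t) (y s t) := by
    intro k s t w hw
    obtain ⟨j, rfl⟩ := Nat.exists_eq_add_of_le hw
    exact hYY j w.length s t w (by omega)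
  refine ⟨y, fun n => ((Y n).2.mono (by omega)).congr (hy n), fun s t w hw => ?_⟩
  have h1 := hy w.length s t w le_rfl
  have h2 := hYY w.length 0 s t w hw
  rw [zero_add] at h2
  exact h1.symm.trans h2

end

/-! ### Characterization of the four spaces -/

section

variable {T γ : ℝ}

theorem exists_div_le_iff {S : Set (Set.Icc (0 : ℝ) T × Set.Icc (0 : ℝ) T)}
    (hS : ∀ p ∈ S, p.1 ≠ p.2) {α : ℝ} {f : Set.Icc (0 : ℝ) T × Set.Icc (0 : ℝ) T → ℝ}
    (hf : ∀ p, 0 ≤ f p) :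
    (∃ C : ℝ, ∀ p ∈ S, f p / |(p.2 : ℝ) - p.1| ^ α ≤ C) ↔
      f =O[𝓟 S] fun p => |(p.2 : ℝ) - p.1| ^ α := by
  rw [isBigO_principal]
  refine exists_congr fun C => forall₂_congr fun p hp => ?_
  have hpos : 0 < |(p.2 : ℝ) - p.1| :=
    abs_pos.2 (sub_ne_zero.2 fun h => hS p hp (Subtype.ext h.symm))
  rw [Real.norm_of_nonneg (hf p), Real.norm_of_nonneg (by positivity),
    div_le_iff₀ (Real.rpow_pos_of_pos hpos α)]

theorem exists_grpNorm_le_iff {n : ℕ} {g : Set.Icc (0 : ℝ) T → Set.Icc (0 : ℝ) T → TensorSeries d}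
    (hg : ∀ s t, g s t [] = 1) :
    (∃ C : ℝ, ∀ s t : Set.Icc (0 : ℝ) T, s < t → grpNorm n (g s t) / |(t : ℝ) - s| ^ γ ≤ C) ↔
      HomogeneousBound (𝓟 {p : Set.Icc (0 : ℝ) T × Set.Icc (0 : ℝ) T | p.1 < p.2})
        (fun p => |(p.2 : ℝ) - p.1| ^ γ) n (fun p => g p.1 p.2) := by
  have h := exists_div_le_iff (S := {p : Set.Icc (0 : ℝ) T × Set.Icc (0 : ℝ) T | p.1 < p.2})
    (α := γ) (f := fun p => grpNorm n (g p.1 p.2)) (fun p hp => ne_of_lt hp) fun p =>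
      Finset.sum_nonneg fun m _ => Real.rpow_nonneg (levelNorm_nonneg _ _) _
  rw [← isBigO_grpNorm_iff (g := fun p : Set.Icc (0 : ℝ) T × Set.Icc (0 : ℝ) T => g p.1 p.2)
    (fun p => by positivity) fun p => hg p.1 p.2, ← h]
  simp only [Prod.forall, Set.mem_ofPred_eq]

theorem incrTrunc_eq (n : ℕ) (X : Set.Icc (0 : ℝ) T → TensorSeries d) (s t : Set.Icc (0 : ℝ) T) :
    incrTrunc n X s t = trunc n (incr X s t) := rfl

/-- Chen's relation holds automatically for increments of characters, so the norm estimate is the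
only analytic content of the definition. -/
theorem mem_truncPaths_iff {X : Set.Icc (0 : ℝ) T → TensorSeries d} :
    X ∈ TruncPaths γ T d ↔ (∀ t, trunc (level γ) (X t) = X t) ∧
      (∀ t : Set.Icc (0 : ℝ) T, (t : ℝ) = 0 → X t = one d) ∧
      (∀ t, IsChar (level γ) (X t)) ∧ IsRough γ (level γ) (incr X) := by
  have hiff (h : ∀ t, IsChar (level γ) (X t)) := exists_grpNorm_le_iff (γ := γ) (n := level γ)
    (g := incrTrunc (level γ) X) fun s t => by
      simp [incrTrunc_eq, trunc, incr, concat_nil, (h s).antipode.1, (h t).1]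
  simp only [TruncPaths, Set.mem_ofPred_eq, mem_grpTrunc_iff, forall_and]
  constructor
  · rintro ⟨⟨h1, h2⟩, h3, h4⟩
    exact ⟨h1, h3, h2, isRough_incr h2 (((hiff h2).1 h4).congr fun p => agreeTo_trunc _ _)⟩
  · rintro ⟨h1, h3, h2, h4⟩
    refine ⟨⟨h1, h2⟩, h3, (hiff h2).2 fun w hw => ?_⟩
    refine ((h4.bound w hw).mono (principal_mono.2 fun p (hp : p.1 < p.2) => hp.le)).congr_left ?_
    exact fun p => (agreeTo_trunc _ _ w hw).symm

theorem mem_seriesPaths_iff {X : Set.Icc (0 : ℝ) T → TensorSeries d} :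
    X ∈ SeriesPaths γ T d ↔ (∀ t : Set.Icc (0 : ℝ) T, (t : ℝ) = 0 → X t = one d) ∧
      (∀ t n, IsChar n (X t)) ∧ ∀ n, IsRough γ n (incr X) := by
  have hiff (h : ∀ t n, IsChar n (X t)) (n : ℕ) := exists_grpNorm_le_iff (γ := γ) (n := n)
    (g := fun s t => trunc n (incr X s t)) fun s t => by
      simp [trunc, incr, concat_nil, (h s 0).antipode.1, (h t 0).1]
  simp only [SeriesPaths, Set.mem_ofPred_eq, mem_grpSeries_iff]
  constructor
  · rintro ⟨h2, h3, h4⟩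
    exact ⟨h3, h2, fun n => isRough_incr (fun t => h2 t n)
      (((hiff h2 n).1 (h4 n)).congr fun p => agreeTo_trunc _ _)⟩
  · rintro ⟨h3, h2, h4⟩
    refine ⟨h2, h3, fun n => (hiff h2 n).2 fun w hw => ?_⟩
    refine (((h4 n).bound w hw).mono
      (principal_mono.2 fun p (hp : p.1 < p.2) => hp.le)).congr_left ?_
    exact fun p => (agreeTo_trunc _ _ w hw).symm

theorem exists_abs_div_le_iff {k : ℕ} {f : Set.Icc (0 : ℝ) T → Set.Icc (0 : ℝ) T → ℝ} :
    (∃ C : ℝ, ∀ s t : Set.Icc (0 : ℝ) T, s ≠ t → |f s t| / |(t : ℝ) - s| ^ (γ * (k : ℝ)) ≤ C) ↔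
      (fun p : Set.Icc (0 : ℝ) T × Set.Icc (0 : ℝ) T => f p.1 p.2)
        =O[𝓟 {p : Set.Icc (0 : ℝ) T × Set.Icc (0 : ℝ) T | p.1 ≠ p.2}]
        fun p => (|(p.2 : ℝ) - p.1| ^ γ) ^ k := by
  have h := exists_div_le_iff (S := {p : Set.Icc (0 : ℝ) T × Set.Icc (0 : ℝ) T | p.1 ≠ p.2})
    (α := γ * k) (f := fun p => |f p.1 p.2|) (fun p hp => hp) fun p => abs_nonneg _
  rw [← isBigO_abs_left]
  simp only [abs_rpow_pow]
  rw [← h]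
  simp only [Prod.forall, Set.mem_ofPred_eq]

/-- The series of values of a functional on words. -/
noncomputable def coef (φ : Module.Dual ℝ (Word d →₀ ℝ)) : TensorSeries d :=
  fun w => φ (Finsupp.single w 1)

/-- The series of values of a functional on words of length at most `n`. -/
noncomputable def coefTrunc {n : ℕ} (φ : Module.Dual ℝ (TruncWord d n →₀ ℝ)) : TensorSeries d :=
  fun w => if h : w.length ≤ n then φ (Finsupp.single ⟨w, h⟩ 1) else 0

theorem coefTrunc_apply {n : ℕ} (φ : Module.Dual ℝ (TruncWord d n →₀ ℝ)) {w : Word d}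
    (h : w.length ≤ n) : coefTrunc φ w = φ (Finsupp.single ⟨w, h⟩ 1) := dif_pos h

theorem trunc_coefTrunc {n : ℕ} (φ : Module.Dual ℝ (TruncWord d n →₀ ℝ)) :
    trunc n (coefTrunc φ) = coefTrunc φ := by
  funext w
  by_cases h : w.length ≤ n <;> simp [trunc, coefTrunc, h]

theorem coef_injective : Function.Injective (coef (d := d)) := by
  intro φ ψ h
  refine Finsupp.lhom_ext' fun w => LinearMap.ext_ring ?_
  exact congrFun h w

theorem coefTrunc_injective {n : ℕ} : Function.Injective (coefTrunc (d := d) (n := n)) := by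
  intro φ ψ h
  refine Finsupp.lhom_ext' fun w => LinearMap.ext_ring ?_
  have := congrFun h w.1
  rwa [coefTrunc_apply φ w.2, coefTrunc_apply ψ w.2] at this

theorem apply_shuffle (φ : Module.Dual ℝ (Word d →₀ ℝ)) (u v : Word d) :
    φ (shuffle u v) = shufflePair (coef φ) u v := by
  rw [shuffle, map_list_sum, List.map_map]
  rfl

/-- Every shuffle of `u` and `v` has length at most `n`, so the restriction to short words loses
nothing. -/
theorem apply_shuffle_subtypeDomain {n : ℕ} (φ : Module.Dual ℝ (TruncWord d n →₀ ℝ)) {u v : Word d}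
    (huv : u.length + v.length ≤ n) :
    φ ((shuffle u v).subtypeDomain (fun w => w.length ≤ n)) =
      shufflePair (coefTrunc φ) u v := by
  have h : ∀ l : List (Word d), (∀ w ∈ l, w.length ≤ n) →
      φ (((l.map fun w => Finsupp.single w (1 : ℝ)).sum).subtypeDomain (fun w => w.length ≤ n)) =
        (l.map (coefTrunc φ)).sum := by
    intro l hl
    induction l with
    | nil => simp
    | cons w l ih =>
      obtain ⟨hw, hl⟩ := List.forall_mem_cons.1 hl
      have hs : (Finsupp.single w (1 : ℝ)).subtypeDomain (fun w => w.length ≤ n) =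
          Finsupp.single (⟨w, hw⟩ : TruncWord d n) 1 := by
        ext v
        simp [Finsupp.single_apply, Subtype.ext_iff]
      rw [List.map_cons, List.sum_cons, Finsupp.subtypeDomain_add, map_add, ih hl, hs,
        List.map_cons, List.sum_cons, coefTrunc_apply φ hw]
  exact h _ fun w hw => (length_of_mem_shuffles hw).trans_le huv

/-- The algebraic conditions match term by term; the bound for reversed times comes from
`IsRough.bound_top`. -/
theorem mem_truncCharacters_iff {Y : Set.Icc (0 : ℝ) T → Set.Icc (0 : ℝ) T →
    Module.Dual ℝ (TruncWord d (level γ) →₀ ℝ)} :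
    Y ∈ TruncCharacters γ T d ↔ IsRough γ (level γ) (fun s t => coefTrunc (Y s t)) := by
  have hlapply : ∀ t, Y t t = Finsupp.lapply ⟨[], Nat.zero_le _⟩ ↔
      AgreeTo (level γ) (coefTrunc (Y t t)) (one d) := by
    have h1 : coefTrunc (Finsupp.lapply (R := ℝ) (⟨[], Nat.zero_le _⟩ : TruncWord d (level γ))) =
        one d := by
      funext w
      rcases w with _ | ⟨a, w⟩ <;> simp [coefTrunc, one]
    intro t
    rw [← coefTrunc_injective.eq_iff, h1, ← trunc_eq_trunc_iff, trunc_coefTrunc, trunc_one]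
  have hchen : ∀ s u t, AgreeTo (level γ) (coefTrunc (Y s t))
      (concat (coefTrunc (Y s u)) (coefTrunc (Y u t))) ↔
      ∀ w : TruncWord d (level γ),
        Y s t (Finsupp.single w 1) = ∑ i ∈ Finset.range (w.1.length + 1),
          Y s u (Finsupp.single ⟨w.1.take i, (w.1.length_take_le' i).trans w.2⟩ 1) *
          Y u t (Finsupp.single
            ⟨w.1.drop i, (List.length_drop.trans_le (Nat.sub_le _ _)).trans w.2⟩ 1) := by
    intro s u t
    rw [Subtype.forall]
    refine forall₂_congr fun w hw => ?_
    rw [coefTrunc_apply _ hw, concat]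
    refine Eq.congr_right (Finset.sum_congr rfl fun i _ => ?_)
    rw [coefTrunc_apply, coefTrunc_apply]
  constructor
  · rintro ⟨h1, ⟨h3, h4⟩, h5⟩
    have h3' := fun t => (hlapply t).1 (h3 t)
    refine ⟨fun s t => ⟨(coefTrunc_apply _ (Nat.zero_le _)).trans (h1 s t).1, fun u v huv => ?_⟩,
      h3', fun s u t => (hchen s u t).2 (h4 s u t), HomogeneousBound.le_of_lt
        (x := fun s t => coefTrunc (Y s t)) h3' fun w hw => ?_⟩
    · rw [← apply_shuffle_subtypeDomain _ huv, coefTrunc_apply _ (show u.length ≤ level γ by omega),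
        coefTrunc_apply _ (show v.length ≤ level γ by omega)]
      exact (h1 s t).2 ⟨u, _⟩ ⟨v, _⟩ huv
    · have := exists_abs_div_le_iff.1 (h5 ⟨w, hw⟩)
      simp only [coefTrunc_apply _ hw]
      exact this.mono (principal_mono.2 fun p (hp : p.1 < p.2) => hp.ne)
  · intro h
    refine ⟨fun s t => ⟨(coefTrunc_apply _ (Nat.zero_le _)).symm.trans (h.char s t).1,
      fun u v huv => ?_⟩, ⟨fun t => (hlapply t).2 (h.refl t),
        fun s u t => (hchen s u t).1 (h.chen s u t)⟩, fun w => ?_⟩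
    · rw [apply_shuffle_subtypeDomain _ huv, (h.char s t).2 _ _ huv, coefTrunc_apply _ u.2,
        coefTrunc_apply _ v.2]
    · have := h.bound_top w.1 w.2
      simp only [coefTrunc_apply _ w.2] at this
      exact exists_abs_div_le_iff.2 (this.mono le_top)

theorem mem_characters_iff {Y : Set.Icc (0 : ℝ) T → Set.Icc (0 : ℝ) T →
    Module.Dual ℝ (Word d →₀ ℝ)} :
    Y ∈ Characters γ T d ↔ ∀ n, IsRough γ n (fun s t => coef (Y s t)) := by
  have hlapply : ∀ t, Y t t = Finsupp.lapply [] ↔ coef (Y t t) = one d := by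
    have h1 : coef (Finsupp.lapply (R := ℝ) ([] : Word d)) = one d := by
      funext w
      rcases w with _ | ⟨a, w⟩ <;> simp [coef, one]
    intro t
    rw [← coef_injective.eq_iff, h1]
  constructor
  · rintro ⟨h1, ⟨h3, h4⟩, h5⟩ n
    have h3' : ∀ t, AgreeTo n (coef (Y t t)) (one d) := fun t => by
      rw [(hlapply t).1 (h3 t)]
      exact AgreeTo.refl _ _
    refine ⟨fun s t => ⟨(h1 s t).1, fun u v huv => ?_⟩,
      h3', fun s u t w _ => h4 s u t w, HomogeneousBound.le_of_lt
        (x := fun s t => coef (Y s t)) h3' fun w hw => ?_⟩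
    · rw [← apply_shuffle]
      exact (h1 s t).2 u v
    · exact (exists_abs_div_le_iff.1 (h5 w)).mono
        (principal_mono.2 fun p (hp : p.1 < p.2) => hp.ne)
  · intro h
    refine ⟨fun s t => ⟨((h 0).char s t).1, fun u v => ?_⟩, ⟨fun t => (hlapply t).2 ?_,
      fun s u t w => (h _).chen s u t w le_rfl⟩, fun w => ?_⟩
    · rw [apply_shuffle]
      exact ((h _).char s t).2 _ _ le_rfl
    · funext w
      exact (h _).refl t w le_rfl
    · exact exists_abs_div_le_iff.2 (((h _).bound_top w le_rfl).mono le_top)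

theorem coefTrunc_I₂ (X : Set.Icc (0 : ℝ) T → TensorSeries d) (s t : Set.Icc (0 : ℝ) T) :
    coefTrunc (I₂ γ T d X s t) = trunc (level γ) (incr X s t) := by
  funext w
  by_cases hw : w.length ≤ level γ
  · simp [coefTrunc_apply _ hw, I₂, incrTrunc_eq]
  · simp [coefTrunc, trunc, hw]

theorem coef_I₃ (X : Set.Icc (0 : ℝ) T → TensorSeries d) (s t : Set.Icc (0 : ℝ) T) :
    coef (I₃ T d X s t) = incr X s t := by
  funext w
  simp [coef, I₃]

/-- Recovers a path from its increments, hence the injectivity of `I₂` and `I₃`. -/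
theorem incr_of_eq_one {X : Set.Icc (0 : ℝ) T → TensorSeries d} {o : Set.Icc (0 : ℝ) T}
    (h : X o = one d) (t : Set.Icc (0 : ℝ) T) : incr X o t = X t := by
  rw [incr, h, antipode_one, one_concat]

theorem eq_of_agreeTo {a b : TensorSeries d} (h : ∀ n, AgreeTo n a b) : a = b :=
  funext fun w => h _ w le_rfl

theorem one_lt_mul_level_succ (hγ : 0 < γ) : 1 < γ * (level γ + 1 : ℕ) := by
  have h := Nat.lt_floor_add_one (1 / γ)
  rw [div_lt_iff₀' hγ] at h
  exact_mod_cast h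

/-! ### The bijections -/

theorem IsRough.mem_seriesPaths {x : Set.Icc (0 : ℝ) T → Set.Icc (0 : ℝ) T → TensorSeries d}
    (hx : ∀ n, IsRough γ n x) {o : Set.Icc (0 : ℝ) T} (ho : (o : ℝ) = 0) :
    x o ∈ SeriesPaths γ T d := by
  refine mem_seriesPaths_iff.2 ⟨fun t ht => ?_, fun t n => (hx n).char o t, fun n =>
    (hx n).congr fun s t => ((hx n).agreeTo_incr o s t).symm⟩
  obtain rfl : t = o := Subtype.ext (ht.trans ho.symm)
  exact eq_of_agreeTo fun n => (hx n).refl t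

theorem bijOn_I₁ (hγ : 0 < γ) (hT : 0 ≤ T) :
    Set.BijOn (I₁ γ T d) (SeriesPaths γ T d) (TruncPaths γ T d) := by
  let o : Set.Icc (0 : ℝ) T := ⟨0, le_rfl, hT⟩
  refine ⟨fun X hX => ?_, fun X hX X' hX' h => ?_, fun X hX => ?_⟩
  · obtain ⟨h1, h2, h3⟩ := mem_seriesPaths_iff.1 hX
    refine mem_truncPaths_iff.2 ⟨fun t => trunc_trunc _ _, fun t ht => ?_,
      fun t => (h2 t _).congr (agreeTo_trunc _ _).symm, (h3 _).congr fun s t => ?_⟩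
    · rw [I₁, h1 t ht, trunc_one]
    · exact (agreeTo_trunc _ _).symm.antipode.concat (agreeTo_trunc _ _).symm
  · obtain ⟨h1, h2, h3⟩ := mem_seriesPaths_iff.1 hX
    obtain ⟨h1', h2', h3'⟩ := mem_seriesPaths_iff.1 hX'
    have hag : ∀ t, AgreeTo (level γ) (X t) (X' t) := fun t =>
      trunc_eq_trunc_iff.1 (congrFun h t)
    funext t
    rw [← incr_of_eq_one (h1 o rfl), ← incr_of_eq_one (h1' o rfl)]
    exact eq_of_agreeTo fun n => (h3 n).agreeTo_of_agreeTo (one_lt_mul_level_succ hγ) hγ (h3' n)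
      (fun s t => (hag s).antipode.concat (hag t)) o t
  · obtain ⟨h0, h1, -, h3⟩ := mem_truncPaths_iff.1 hX
    -- The extended increments based at time zero form the required preimage.
    obtain ⟨y, hy, hyX⟩ := h3.exists_extension_top hT hγ (one_lt_mul_level_succ hγ)
    refine ⟨y o, IsRough.mem_seriesPaths hy rfl, ?_⟩
    funext t
    rw [I₁, trunc_eq_trunc_iff.2 (hyX o t), incr_of_eq_one (h1 o rfl), h0]

theorem bijOn_I₂ (hT : 0 ≤ T) :
    Set.BijOn (I₂ γ T d) (TruncPaths γ T d) (TruncCharacters γ T d) := by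
  let o : Set.Icc (0 : ℝ) T := ⟨0, le_rfl, hT⟩
  refine ⟨fun X hX => ?_, fun X hX X' hX' h => ?_, fun Y hY => ?_⟩
  · obtain ⟨-, -, -, h3⟩ := mem_truncPaths_iff.1 hX
    refine mem_truncCharacters_iff.2 (h3.congr fun s t => ?_)
    rw [coefTrunc_I₂]
    exact (agreeTo_trunc _ _).symm
  · obtain ⟨h0, h1, -, -⟩ := mem_truncPaths_iff.1 hX
    obtain ⟨h0', h1', -, -⟩ := mem_truncPaths_iff.1 hX'
    funext t
    rw [← h0, ← h0', ← incr_of_eq_one (h1 o rfl), ← incr_of_eq_one (h1' o rfl), ← coefTrunc_I₂,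
      ← coefTrunc_I₂, h]
  · have hx := mem_truncCharacters_iff.1 hY
    have hincr := fun s t => hx.agreeTo_incr o s t
    refine ⟨fun t => coefTrunc (Y o t), mem_truncPaths_iff.2 ⟨fun t => trunc_coefTrunc _,
      fun t ht => ?_, fun t => hx.char o t, hx.congr fun s t => (hincr s t).symm⟩, ?_⟩
    · obtain rfl : t = o := Subtype.ext ht
      rw [← trunc_coefTrunc, trunc_eq_trunc_iff.2 (hx.refl o), trunc_one]
    · funext s t
      apply coefTrunc_injective
      rw [coefTrunc_I₂, trunc_eq_trunc_iff.2 (hincr s t), trunc_coefTrunc]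

theorem bijOn_I₃ (hT : 0 ≤ T) :
    Set.BijOn (I₃ T d) (SeriesPaths γ T d) (Characters γ T d) := by
  let o : Set.Icc (0 : ℝ) T := ⟨0, le_rfl, hT⟩
  refine ⟨fun X hX => ?_, fun X hX X' hX' h => ?_, fun Y hY => ?_⟩
  · obtain ⟨-, -, h3⟩ := mem_seriesPaths_iff.1 hX
    refine mem_characters_iff.2 fun n => ?_
    simpa only [coef_I₃] using h3 n
  · obtain ⟨h1, -, -⟩ := mem_seriesPaths_iff.1 hX
    obtain ⟨h1', -, -⟩ := mem_seriesPaths_iff.1 hX'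
    funext t
    rw [← incr_of_eq_one (h1 o rfl), ← incr_of_eq_one (h1' o rfl), ← coef_I₃, ← coef_I₃, h]
  · have hx := mem_characters_iff.1 hY
    refine ⟨fun t => coef (Y o t), IsRough.mem_seriesPaths hx rfl, ?_⟩
    funext s t
    apply coef_injective
    rw [coef_I₃]
    exact eq_of_agreeTo fun n => (hx n).agreeTo_incr o s t

end

end RoughPath

theorem mainTheorem1 (γ : ℝ) (hγ₀ : 0 < γ) (hγ₁ : γ < 1) (T : ℝ) (hT : 0 ≤ T) (d : ℕ) :
    Set.BijOn (RoughPath.I₁ γ T d) (RoughPath.SeriesPaths γ T d) (RoughPath.TruncPaths γ T d) ∧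
    Set.BijOn (RoughPath.I₂ γ T d) (RoughPath.TruncPaths γ T d)
      (RoughPath.TruncCharacters γ T d) ∧
    Set.BijOn (RoughPath.I₃ T d) (RoughPath.SeriesPaths γ T d) (RoughPath.Characters γ T d) :=
  ⟨RoughPath.bijOn_I₁ hγ₀ hT, RoughPath.bijOn_I₂ hT, RoughPath.bijOn_I₃ hT⟩
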